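/- Identify a homogeneous quadratic vector field $p$ on $\mathbb C^3$, $p(x)_k=\sum_{1\le i\le j\le 3}\beta_{ijk}x_ix_j$, with its coefficients $(\beta_{ijk})\in\mathbb C^{18}$. An idempotent of $p$ is a $v\neq 0$ with $p(v)=v$; a nilpotent of $p$ is a $w\ne 0$ with $p(w)=0$. The multiplicity of an idempotent $v$ is its multiplicity as a solution of $p(x)-x=0$, i.e. the complex dimension of the local ring at $v$ of the scheme defined by $p(x)-x$. Call $p$ distinguished, with parameters $\gamma=(\gamma_{ij})\in\mathbb C^{9}$, if the standard basis vectors $e_1,e_2,e_3$ and the vectors $v_i=\gamma_{i1}e_1+\gamma_{i2}e_2+\gamma_{i3}e_3$ $(i=1,2,3)$ are idempotents of $p$ and the matrix $A$ with rows $(\gamma_{i1}\gamma_{i2},\,\gamma_{i2}\gamma_{i3},\,\gamma_{i3}\gamma_{i1})$ is invertible (so that these six idempotents are distinct). (a) The set of all coordinate transforms $T^{-1}\circ p\circ T$, with $T\in GL_3(\mathbb C)$ and $p$ distinguished, contains a nonempty Zariski-open subset of $\mathbb C^{18}$. (b) There are rational functions $s_k=N_k/D_k$ $(k=1,2,3)$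 of the nine parameters $\gamma_{ij}$ (with $N_k,D_k$ polynomials over $\mathbb C$) such that the following holds. For every distinguished $p$ with parameters $\gamma$ that has no nilpotent, $D_k(\gamma)\neq 0$ for all $k$, and $p$ has precisely seven idempotents counted with multiplicity, namely $e_1,e_2,e_3,v_1,v_2,v_3$ and $s(\gamma)=(s_1(\gamma),s_2(\gamma),s_3(\gamma))$: these are all the idempotents, and the multiplicity of each idempotent is the number of times it occurs in this list. In particular $p$ has precisely seven distinct idempotents if and only if all its idempotents have multiplicity one. Moreover there is a nonempty Zariski-open set $U\subseteq\mathbb C^9$ such that for every $\gamma\in U$ a distinguished field with parameters $\gamma$ exists, and every such field has no nilpotent and has precisely seven distinct idempotents. -/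

import Mathlib

namespace QuadField

/-- Index set of the structure coefficients: a monomial `x_i x_j` with `i ≤ j`, and a component
`k`. It has 18 elements. -/
abbrev CoeffIndex : Type := {ij : Fin 3 × Fin 3 // ij.1 ≤ ij.2} × Fin 3

/-- A homogeneous quadratic vector field on `ℂ³`, identified with its structure coefficients,
that is, with a point of `ℂ¹⁸`. -/
abbrev Coeff : Type := CoeffIndex → ℂ

/-- The components of the vector field as polynomials. -/
noncomputable def comp (β : Coeff) (k : Fin 3) : MvPolynomial (Fin 3) ℂ :=
  ∑ ij : {ij : Fin 3 × Fin 3 // ij.1 ≤ ij.2},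
    MvPolynomial.C (β (ij, k)) * (MvPolynomial.X ij.1.1 * MvPolynomial.X ij.1.2)

/-- The homogeneous quadratic map `ℂ³ → ℂ³` with structure coefficients `β`. -/
noncomputable def field (β : Coeff) (x : Fin 3 → ℂ) : Fin 3 → ℂ :=
  fun k => MvPolynomial.eval x (comp β k)

/-- `v` is an idempotent: `p(v) = v ≠ 0`. -/
def IsIdem (β : Coeff) (v : Fin 3 → ℂ) : Prop := field β v = v ∧ v ≠ 0

/-- `w` is a nilpotent: `w ≠ 0` and `p(w) = 0`. -/
def IsNil (β : Coeff) (w : Fin 3 → ℂ) : Prop := w ≠ 0 ∧ field β w = 0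

/-- The point `v_i = γ_{i1} e_1 + γ_{i2} e_2 + γ_{i3} e_3` of `ℂ³`. -/
def vec (γ : Fin 3 × Fin 3 → ℂ) (i : Fin 3) : Fin 3 → ℂ := fun j => γ (i, j)

/-- The matrix `A`, with `i`-th row `(γ_{i1} γ_{i2}, γ_{i2} γ_{i3}, γ_{i3} γ_{i1})`. -/
def matA (γ : Fin 3 × Fin 3 → ℂ) : Matrix (Fin 3) (Fin 3) ℂ :=
  Matrix.of fun i => ![γ (i, 0) * γ (i, 1), γ (i, 1) * γ (i, 2), γ (i, 2) * γ (i, 0)]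

/-- The field `β` is distinguished, with parameters `γ`. (Invertibility of `A` forces
`e_1, e_2, e_3, v_1, v_2, v_3` to be six different points.) -/
structure IsDistinguishedWith (γ : Fin 3 × Fin 3 → ℂ) (β : Coeff) : Prop where
  idem_e : ∀ i : Fin 3, IsIdem β (Pi.single i 1)
  idem_v : ∀ i : Fin 3, IsIdem β (vec γ i)
  isUnit_A : IsUnit (matA γ)

/-- The field `β` is distinguished. -/
def IsDistinguished (β : Coeff) : Prop := ∃ γ, IsDistinguishedWith γ β

/-- `β` is obtained from `β'` by a linear coordinate transformation: `p = T⁻¹ ∘ p' ∘ T`. -/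
def IsTransformOf (β β' : Coeff) : Prop :=
  ∃ T : GL (Fin 3) ℂ, ∀ x : Fin 3 → ℂ,
    field β x =
      (T⁻¹ : GL (Fin 3) ℂ).val.mulVec (field β' (T.val.mulVec x))

/-- Zariski-open subsets of the affine space `ℂ^σ`. -/
def IsZariskiOpen {σ : Type} (U : Set (σ → ℂ)) : Prop :=
  ∃ I : Ideal (MvPolynomial σ ℂ), U = (MvPolynomial.zeroLocus ℂ I)ᶜ

/-- The ideal generated by the components of `p(x) - x`. -/
noncomputable def fixIdeal (β : Coeff) : Ideal (MvPolynomial (Fin 3) ℂ) :=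
  Ideal.span (Set.range fun k => comp β k - MvPolynomial.X k)

/-- The maximal ideal of the polynomials vanishing at `v`. -/
noncomputable def pointIdeal (v : Fin 3 → ℂ) : Ideal (MvPolynomial (Fin 3) ℂ) :=
  RingHom.ker (MvPolynomial.eval v)

instance pointIdeal_isPrime (v : Fin 3 → ℂ) : (pointIdeal v).IsPrime :=
  RingHom.ker_isPrime (MvPolynomial.eval v)

/-- The multiplicity of `v` as a solution of `p(x) = x`: the complex dimension of the local ring
of the scheme `p(x) - x = 0` at `v`. -/
noncomputable def mult (β : Coeff) (v : Fin 3 → ℂ) : ℕ :=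
  Module.finrank ℂ
    (Localization.AtPrime (pointIdeal v) ⧸
      (fixIdeal β).map (algebraMap (MvPolynomial (Fin 3) ℂ)
        (Localization.AtPrime (pointIdeal v))))

/-- The point with coordinates `N_k(γ) / D_k(γ)`. -/
noncomputable def ratPoint (N D : Fin 3 → MvPolynomial (Fin 3 × Fin 3) ℂ)
    (γ : Fin 3 × Fin 3 → ℂ) : Fin 3 → ℂ :=
  fun k => MvPolynomial.eval γ (N k) / MvPolynomial.eval γ (D k)

/-- The list `e_1, e_2, e_3, v_1, v_2, v_3, s`. -/
def seven (γ : Fin 3 × Fin 3 → ℂ) (s : Fin 3 → ℂ) : Fin 7 → (Fin 3 → ℂ) :=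
  ![Pi.single 0 1, Pi.single 1 1, Pi.single 2 1, vec γ 0, vec γ 1, vec γ 2, s]

end QuadField

/-! Part (b). Because the `e_i` are idempotents, the field has the form `p_k = x_k² + ∑ c_{km} x_m
x_{m+1}`, and the conditions `p(v_i) = v_i` determine `c`, since `A` is invertible. Without
nilpotents the system `p(x) = x` has no solution at infinity, so its coordinate ring has length at
most 8, as in Bézout's theorem (`HasCross.finite_and_finrank_le`). Seven solutions are known: `0`,
the `e_i` and the `v_i`. Let `J` be the Jacobian determinant of `p(x) - x`. If there are eight
simple solutions, the Euler–Jacobi relation says that `g / J` sums to zero over them for every `g`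
of degree at most 2. Hence the second moments of the seven known points in homogeneous coordinates,
with weights `1 / J`, form a matrix of rank one, proportional to the one given by the eighth
solution, whose coordinates are ratios of its entries.

Clearing denominators makes these moments polynomials in `γ` (`moment`). Their 2×2 minors vanish
identically, because they vanish near one parameter value, where the inverse function theorem
supplies the eighth solution (`moment_minors`). If `J` vanishes at a known solution, that solution
has multiplicity at least two (`mult_ne_one`). The bound 8 allows only one such solution, and the
formula then returns it. In either case the list of eight solutions exhausts the bound, so
multiplicities are numbers of occurrences (`IsDistinguishedWith.mult_eq_count`). For generic `γ` the
determinant `nilNum` excludes nilpotents and no `J` vanishes.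

Part (a). Up to scalars that can be absorbed in `T`, the map from `(T, γ)` to structure coefficients
is polynomial. Its image contains a neighbourhood of the field `x_k²`, because six of the fixed
points of that field persist under perturbation. So the map is dominant, and by Chevalley's theorem
its image contains a nonempty Zariski-open set. -/

namespace QuadField

open Filter Topology

/-! ### Zariski-open sets and dominant polynomial maps -/

theorem isZariskiOpen_eval_ne_zero {σ : Type} (F : MvPolynomial σ ℂ) :
    IsZariskiOpen {x : σ → ℂ | MvPolynomial.eval x F ≠ 0} := by
  refine ⟨Ideal.span {F}, ?_⟩
  ext x
  simp [MvPolynomial.zeroLocus_span, MvPolynomial.aeval_eq_eval]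

/-- A polynomial vanishing near a point is zero. -/
theorem eq_zero_of_eventually_eval_eq_zero {σ : Type} [Fintype σ] (F : MvPolynomial σ ℂ)
    (x₀ : σ → ℂ) (h : ∀ᶠ x in 𝓝 x₀, MvPolynomial.eval x F = 0) : F = 0 := by
  obtain ⟨ε, hε, hb⟩ := Metric.eventually_nhds_iff_ball.mp h
  refine MvPolynomial.funext_set (fun i => Metric.ball (x₀ i) ε) (fun i => ?_) fun x hx => ?_
  · exact infinite_of_mem_nhds (x₀ i) (Metric.ball_mem_nhds _ hε)
  · rw [map_zero]
    refine hb x ?_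
    rw [ball_pi _ hε]
    exact hx

/-- A dominant polynomial map sends a nonempty principal open set to a set that contains a nonempty
principal open set. -/
theorem exists_forall_exists_eval_eq {σ τ : Type} [Finite σ] [Finite τ]
    (Ψ : σ → MvPolynomial τ ℂ) (g : MvPolynomial τ ℂ) (hg : g ≠ 0)
    (hΨ : Function.Injective (MvPolynomial.aeval (R := ℂ) Ψ)) :
    ∃ a : MvPolynomial σ ℂ, a ≠ 0 ∧ ∀ y, MvPolynomial.eval y a ≠ 0 →
      ∃ x, MvPolynomial.eval x g ≠ 0 ∧ ∀ i, MvPolynomial.eval x (Ψ i) = y i := by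
  set φ : MvPolynomial σ ℂ →+* MvPolynomial τ ℂ := (MvPolynomial.aeval (R := ℂ) Ψ).toRingHom
    with hφ
  have hfp : φ.FinitePresentation := by
    refine RingHom.FinitePresentation.of_finiteType.mp ?_
    refine RingHom.FiniteType.of_comp_finiteType (f := MvPolynomial.C) ?_
    have : φ.comp MvPolynomial.C = (MvPolynomial.C : ℂ →+* MvPolynomial τ ℂ) := by
      ext; simp [hφ]
    rw [this]
    exact (RingHom.finiteType_algebraMap (A := ℂ) (B := MvPolynomial τ ℂ)).mpr inferInstance
  obtain ⟨S, hS⟩ := PrimeSpectrum.exists_constructibleSetData_iff.mpr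
    (PrimeSpectrum.isConstructible_comap_image hfp
      (PrimeSpectrum.isConstructible_basicOpen (f := g)))
  -- By Chevalley the image is constructible. Dominance puts the generic point in it, and a locally
  -- closed piece that contains the generic point is a nonempty basic open set.
  have hbot : (⊥ : PrimeSpectrum (MvPolynomial σ ℂ)) ∈ S.toSet := by
    rw [hS]
    refine ⟨⊥, ?_, ?_⟩
    · simpa using hg
    · ext z
      exact map_eq_zero_iff _ hΨ
  obtain ⟨C, hC, hCb⟩ := Set.mem_iUnion₂.mp hbot
  have hg0 : ∀ i, C.g i = 0 := fun i => by
    have := hCb.1 (Set.mem_range_self i)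
    simpa using this
  have hf0 : C.f ≠ 0 := by
    have := hCb.2
    simpa using this
  refine ⟨C.f, hf0, fun y hy => ?_⟩
  let m : PrimeSpectrum (MvPolynomial σ ℂ) :=
    ⟨RingHom.ker (MvPolynomial.eval y), RingHom.ker_isPrime _⟩
  have hm : m ∈ S.toSet := by
    refine Set.mem_iUnion₂.mpr ⟨C, hC, ?_, ?_⟩
    · rintro _ ⟨i, rfl⟩
      rw [hg0]; exact zero_mem _
    · simpa [m, RingHom.mem_ker] using hy
  rw [hS] at hm
  obtain ⟨P, hgP, hP⟩ := hm
  have hgP' : g ∉ P.asIdeal := hgP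
  have hPp := P.isPrime
  -- The prime over the point `y` need not be maximal. The Nullstellensatz replaces it by one of its
  -- zeros at which `g` does not vanish.
  rw [← MvPolynomial.IsPrime.vanishingIdeal_zeroLocus (K := ℂ) P.asIdeal,
    MvPolynomial.mem_vanishingIdeal_iff] at hgP'
  push Not at hgP'
  obtain ⟨x, hx, hgx⟩ := hgP'
  refine ⟨x, by simpa [MvPolynomial.aeval_eq_eval] using hgx, fun i => ?_⟩
  have h1 : (MvPolynomial.X i - MvPolynomial.C (y i) : MvPolynomial σ ℂ) ∈ m.asIdeal := by
    simp [m, RingHom.mem_ker]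
  rw [← hP] at h1
  have h2 := hx _ h1
  simpa [hφ, MvPolynomial.aeval_eq_eval, sub_eq_zero] using h2

end QuadField

/-! ### Local multiplicities and the length of the coordinate ring -/

namespace QuadField

open MvPolynomial

/-- The coordinate ring of the scheme `p(x) = x`. -/
abbrev FixRing (β : Coeff) : Type := MvPolynomial (Fin 3) ℂ ⧸ fixIdeal β

/-- The local ring of the scheme `p(x) = x` at `v`. -/
abbrev LocalFixRing (β : Coeff) (v : Fin 3 → ℂ) : Type :=
  Localization.AtPrime (pointIdeal v) ⧸
    (fixIdeal β).map (algebraMap (MvPolynomial (Fin 3) ℂ) (Localization.AtPrime (pointIdeal v)))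

theorem mem_pointIdeal {v : Fin 3 → ℂ} {f : MvPolynomial (Fin 3) ℂ} :
    f ∈ pointIdeal v ↔ eval v f = 0 := RingHom.mem_ker

theorem fixIdeal_le_pointIdeal {β : Coeff} {v : Fin 3 → ℂ} (hv : field β v = v) :
    fixIdeal β ≤ pointIdeal v := by
  refine Ideal.span_le.mpr ?_
  rintro _ ⟨k, rfl⟩
  have := congrFun hv k
  simp only [field] at this
  simp [mem_pointIdeal, this]

/-- The prime ideal of the coordinate ring of `p(x) = x` given by a solution. -/
noncomputable def fixPrime (β : Coeff) (v : Fin 3 → ℂ) (hv : field β v = v) :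
    PrimeSpectrum (FixRing β) :=
  ⟨(pointIdeal v).map (Ideal.Quotient.mk (fixIdeal β)),
    Ideal.map_isPrime_of_surjective Ideal.Quotient.mk_surjective
      (by rw [Ideal.mk_ker]; exact fixIdeal_le_pointIdeal hv)⟩

theorem mk_mem_fixPrime {β : Coeff} {v : Fin 3 → ℂ} {hv : field β v = v}
    {f : MvPolynomial (Fin 3) ℂ} :
    Ideal.Quotient.mk (fixIdeal β) f ∈ (fixPrime β v hv).asIdeal ↔ eval v f = 0 := by
  rw [← mem_pointIdeal]
  have := Ideal.comap_map_of_surjective' (Ideal.Quotient.mk (fixIdeal β))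
    Ideal.Quotient.mk_surjective (pointIdeal v)
  rw [Ideal.mk_ker, sup_eq_left.mpr (fixIdeal_le_pointIdeal hv)] at this
  conv_rhs => rw [← this]
  rfl

theorem fixPrime_injective {β : Coeff} {v w : Fin 3 → ℂ} {hv : field β v = v}
    {hw : field β w = w} (h : fixPrime β v hv = fixPrime β w hw) : v = w := by
  funext k
  have h1 : Ideal.Quotient.mk (fixIdeal β) (X k - C (v k)) ∈ (fixPrime β v hv).asIdeal := by
    rw [mk_mem_fixPrime]; simp
  rw [h, mk_mem_fixPrime] at h1
  simp only [map_sub, eval_X, eval_C, sub_eq_zero] at h1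
  exact h1.symm

/-- Localization commutes with quotients, so the multiplicity can be read off inside the coordinate
ring. -/
theorem mult_eq_finrank {β : Coeff} {v : Fin 3 → ℂ} (hv : field β v = v) :
    mult β v = Module.finrank ℂ (Localization.AtPrime (fixPrime β v hv).asIdeal) := by
  have hM : Algebra.algebraMapSubmonoid (FixRing β) (pointIdeal v).primeCompl =
      (fixPrime β v hv).asIdeal.primeCompl := by
    ext z
    constructor
    · rintro ⟨f, hf, rfl⟩
      exact fun h => hf (mem_pointIdeal.mpr (mk_mem_fixPrime.mp h))
    · intro hz
      obtain ⟨f, rfl⟩ := Ideal.Quotient.mk_surjective z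
      exact ⟨f, fun h => hz (mk_mem_fixPrime.mpr (mem_pointIdeal.mp h)), rfl⟩
  have h1 : IsLocalization (fixPrime β v hv).asIdeal.primeCompl (LocalFixRing β v) := by
    rw [← hM]; infer_instance
  let e : Localization.AtPrime (fixPrime β v hv).asIdeal ≃ₐ[FixRing β] LocalFixRing β v :=
    IsLocalization.algEquiv (fixPrime β v hv).asIdeal.primeCompl
      (Localization.AtPrime (fixPrime β v hv).asIdeal) (LocalFixRing β v)
  have : IsScalarTower ℂ (FixRing β) (LocalFixRing β v) := by
    refine IsScalarTower.of_algebraMap_eq (R := ℂ) (S := FixRing β) (A := LocalFixRing β v)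
      fun z => ?_
    rfl
  let e' : Localization.AtPrime (fixPrime β v hv).asIdeal ≃ₐ[ℂ] LocalFixRing β v :=
    e.restrictScalars ℂ
  exact (LinearEquiv.finrank_eq e'.toLinearEquiv).symm

theorem finite_localization {β : Coeff} [Module.Finite ℂ (FixRing β)]
    (P : PrimeSpectrum (FixRing β)) :
    Module.Finite ℂ (Localization.AtPrime P.asIdeal) := by
  have : IsArtinianRing (FixRing β) := IsArtinianRing.of_finite ℂ _
  exact .of_surjective (IsScalarTower.toAlgHom ℂ (FixRing β) _).toLinearMap
    (IsArtinianRing.localization_surjective P.asIdeal.primeCompl _)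

/-- A finite algebra is the product of its localizations, and different solutions account for
different factors. -/
theorem sum_mult_le_finrank {β : Coeff} [Module.Finite ℂ (FixRing β)] (Z : Finset (Fin 3 → ℂ))
    (hZ : ∀ v ∈ Z, field β v = v) :
    ∑ v ∈ Z, mult β v ≤ Module.finrank ℂ (FixRing β) := by
  classical
  have : IsArtinianRing (FixRing β) := IsArtinianRing.of_finite ℂ _
  have : Fintype (PrimeSpectrum (FixRing β)) := .ofFinite _
  let e : FixRing β ≃ₐ[FixRing β] PrimeSpectrum.PiLocalization (FixRing β) :=
    .ofBijective (PrimeSpectrum.toPiLocalization _)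
      PrimeSpectrum.toPiLocalization_bijective
  have hfin := fun P : PrimeSpectrum (FixRing β) => finite_localization P
  have hfree : ∀ P : PrimeSpectrum (FixRing β),
      Module.Free ℂ (Localization P.asIdeal.primeCompl) :=
    fun P => Module.Free.of_divisionRing ℂ (Localization.AtPrime P.asIdeal)
  rw [LinearEquiv.finrank_eq (e.restrictScalars ℂ).toLinearEquiv,
    Module.finrank_pi_fintype, ← Finset.sum_attach]
  have hinj : Function.Injective fun v : {v // v ∈ Z} => fixPrime β v.1 (hZ v.1 v.2) :=
    fun v w h => Subtype.ext (fixPrime_injective h)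
  rw [show ∑ x ∈ Z.attach, mult β x.1 = ∑ P ∈ Z.attach.map ⟨_, hinj⟩,
      Module.finrank ℂ (Localization.AtPrime P.asIdeal) by
    rw [Finset.sum_map]
    exact Finset.sum_congr rfl fun v _ => mult_eq_finrank (hZ v.1 v.2)]
  exact Finset.sum_le_sum_of_subset (Finset.subset_univ _)

theorem mult_pos {β : Coeff} [Module.Finite ℂ (FixRing β)] {v : Fin 3 → ℂ}
    (hv : field β v = v) : 0 < mult β v := by
  rw [mult_eq_finrank hv]
  have := finite_localization (fixPrime β v hv)
  exact Module.finrank_pos (R := ℂ) (M := Localization.AtPrime (fixPrime β v hv).asIdeal)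

end QuadField

/-! ### Degenerate Jacobian and multiplicity -/

namespace QuadField

open MvPolynomial

/-- The Jacobian matrix of `p(x) - x`. -/
noncomputable def jac (β : Coeff) (x : Fin 3 → ℂ) : Matrix (Fin 3) (Fin 3) ℂ :=
  Matrix.of fun k l => eval x (pderiv l (comp β k - X k))

theorem localization_algebraMap_isUnit {v : Fin 3 → ℂ} {f : MvPolynomial (Fin 3) ℂ}
    (hf : eval v f ≠ 0) :
    IsUnit (algebraMap (MvPolynomial (Fin 3) ℂ) (Localization.AtPrime (pointIdeal v)) f) :=
  IsLocalization.map_units (M := (pointIdeal v).primeCompl) _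
    ⟨f, fun h => hf (mem_pointIdeal.mp h)⟩

/-- The canonical map from polynomials to the local ring of `p(x) = x` at a point. -/
noncomputable def toLocalFixRing (β : Coeff) (v : Fin 3 → ℂ) :
    MvPolynomial (Fin 3) ℂ →ₐ[ℂ] LocalFixRing β v :=
  (Ideal.Quotient.mkₐ ℂ _).comp (IsScalarTower.toAlgHom ℂ _ _)

theorem toLocalFixRing_isUnit {β : Coeff} {v : Fin 3 → ℂ} {f : MvPolynomial (Fin 3) ℂ}
    (hf : eval v f ≠ 0) : IsUnit (toLocalFixRing β v f) :=
  (localization_algebraMap_isUnit hf).map (Ideal.Quotient.mkₐ ℂ _)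

theorem exists_mul_mem_fixIdeal {β : Coeff} {v : Fin 3 → ℂ} {f : MvPolynomial (Fin 3) ℂ}
    (hf : toLocalFixRing β v f = 0) : ∃ s, eval v s ≠ 0 ∧ s * f ∈ fixIdeal β := by
  have h := Ideal.Quotient.eq_zero_iff_mem.mp hf
  obtain ⟨s, hs, h⟩ := (IsLocalization.algebraMap_mem_map_algebraMap_iff
    (pointIdeal v).primeCompl _ _ _).mp h
  exact ⟨s, fun h0 => hs (mem_pointIdeal.mpr h0), h⟩

theorem comp_sub_X_mem_fixIdeal (β : Coeff) (k : Fin 3) : comp β k - X k ∈ fixIdeal β :=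
  Ideal.subset_span ⟨k, rfl⟩

/-- A kernel vector of the Jacobian is a tangent vector of the scheme: it kills the generators, and
by the Leibniz rule it kills their multiples because the generators vanish at `v`. -/
theorem sum_mul_pderiv_eq_zero {β : Coeff} {v d : Fin 3 → ℂ} (hv : field β v = v)
    (hd : (jac β v).mulVec d = 0) {f : MvPolynomial (Fin 3) ℂ} (hf : f ∈ fixIdeal β) :
    ∑ l, d l * eval v (pderiv l f) = 0 := by
  induction hf using Submodule.span_induction with
  | mem f hf =>
    obtain ⟨k, rfl⟩ := hf
    have := congrFun hd k
    simp only [Matrix.mulVec, dotProduct, jac, Matrix.of_apply, Pi.zero_apply] at this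
    rw [← this]
    exact Finset.sum_congr rfl fun _ _ => mul_comm _ _
  | zero => simp
  | add f g _ _ hf hg => simp only [map_add, mul_add, Finset.sum_add_distrib, hf, hg, add_zero]
  | smul a f hf h =>
    have h0 : eval v f = 0 := mem_pointIdeal.mp (fixIdeal_le_pointIdeal hv hf)
    simp only [smul_eq_mul, pderiv_mul, map_add, map_mul, h0, mul_zero, zero_add]
    rw [← mul_zero (eval v a), ← h, Finset.mul_sum]
    exact Finset.sum_congr rfl fun _ _ => by ring

/-- If the local ring were `ℂ`, each `x_l - v_l` would vanish in it, so `s (x_l - v_l)` would lie in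
the ideal for some `s` with `s(v) ≠ 0`. Differentiating along a kernel vector `d` then gives `s(v)
d_l = 0`. -/
theorem mult_ne_one {β : Coeff} {v : Fin 3 → ℂ} (hv : field β v = v)
    (hJ : (jac β v).det = 0) : mult β v ≠ 1 := by
  intro h1
  change Module.finrank ℂ (LocalFixRing β v) = 1 at h1
  have hnt : Nontrivial (LocalFixRing β v) :=
    Module.nontrivial_of_finrank_pos (R := ℂ) (by omega)
  have hsc := (finrank_eq_one_iff_of_nonzero' (1 : LocalFixRing β v) one_ne_zero).mp h1
  obtain ⟨d, hd0, hd⟩ := Matrix.exists_mulVec_eq_zero_iff.mpr hJ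
  refine hd0 (funext fun l => ?_)
  obtain ⟨c, hc⟩ := hsc (toLocalFixRing β v (X l - C (v l)))
  have h2 : toLocalFixRing β v (X l - C (v l) - C c) = 0 := by
    rw [map_sub, ← hc, sub_eq_zero, ← Algebra.algebraMap_eq_smul_one]
    exact ((toLocalFixRing β v).commutes c).symm
  have hc0 : c = 0 := by
    by_contra hc0
    have : IsUnit (toLocalFixRing β v (X l - C (v l) - C c)) :=
      toLocalFixRing_isUnit (by simpa using hc0)
    rw [h2] at this
    exact not_isUnit_zero this
  rw [hc0, map_zero, sub_zero] at h2
  obtain ⟨s, hs, hmem⟩ := exists_mul_mem_fixIdeal h2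
  have := sum_mul_pderiv_eq_zero hv hd hmem
  simp only [pderiv_mul, map_add, map_mul, map_sub, eval_X, eval_C, sub_self, mul_zero, zero_add,
    pderiv_C, sub_zero, pderiv_X, Pi.single_apply] at this
  rw [Finset.sum_eq_single l] at this
  · simpa [hs] using this
  · intro b _ hb
    simp [hb.symm]
  · simp

end QuadField

/-! ### Symmetric tensors apolar to three quadrics without common zero -/

namespace QuadField

open MvPolynomial

/-- The value at `x` of the quadratic map `x_k² + ∑ c_{km} x_m x_{m+1}` (indices modulo 3). -/
def quadMap {R : Type*} [CommRing R] (c : Fin 3 → Fin 3 → R) (x : Fin 3 → R) (k : Fin 3) : R :=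
  x k ^ 2 + ∑ m, c k m * (x m * x (m + 1))

/-- The bilinear form `M` is annihilated by the components of `quadMap c`. -/
def Apolar (c : Fin 3 → Fin 3 → ℂ) (M : Fin 3 → Fin 3 → ℂ) : Prop :=
  ∀ k, M k k + ∑ m, c k m * M m (m + 1) = 0

theorem Apolar.smul {c M : Fin 3 → Fin 3 → ℂ} (h : Apolar c M) (r : ℂ) :
    Apolar c (fun i j => r * M i j) := fun k => by
  have := h k
  simp only [Fin.sum_univ_three] at this ⊢
  linear_combination r * this

theorem Apolar.add {c M N : Fin 3 → Fin 3 → ℂ} (h : Apolar c M) (h' : Apolar c N) :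
    Apolar c (fun i j => M i j + N i j) := fun k => by
  have h1 := h k
  have h2 := h' k
  simp only [Fin.sum_univ_three] at h1 h2 ⊢
  linear_combination h1 + h2

/-- Apolarity expresses the diagonal entries through the cross entries. -/
theorem Apolar.eq_zero_of_cross {c M : Fin 3 → Fin 3 → ℂ} (h : Apolar c M)
    (hs : ∀ i j, M i j = M j i) (h0 : ∀ m, M m (m + 1) = 0) : ∀ i j, M i j = 0 := by
  have hd : ∀ k, M k k = 0 := fun k => by simpa [h0] using h k
  have h1 := h0 0
  have h2 := h0 1
  have h3 := h0 2
  intro i j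
  fin_cases i <;> fin_cases j <;> first | exact hd _ | assumption | (rw [hs]; assumption)

/-- An apolar form of rank at most one vanishes if there are no nilpotents. -/
theorem Apolar.eq_zero_of_minors {c M : Fin 3 → Fin 3 → ℂ}
    (hc : ∀ w, (∀ k, quadMap c w k = 0) → w = 0) (h : Apolar c M)
    (hs : ∀ i j, M i j = M j i) (hm : ∀ i j k l, M i j * M k l = M i l * M k j) :
    ∀ i j, M i j = 0 := by
  have hd : ∀ a, M a a = 0 := by
    intro a
    -- A row of a symmetric matrix of rank one is a zero of the quadrics apolar to it.
    have hw := hc (M a) fun k => by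
      have h1 : ∀ i j, M a i * M a j = M a a * M i j := fun i j => by
        rw [hs a i, hm i a a j]; ring
      simp only [quadMap, sq, h1]
      have := h k
      simp only [Fin.sum_univ_three] at this ⊢
      linear_combination M a a * this
    exact congrFun hw a
  intro i j
  have : M i j * M j i = 0 := by rw [hm, hd, hd, mul_zero]
  rw [hs j i] at this
  exact mul_self_eq_zero.mp this

/-- Symmetry forces `F` to be a multiple of `y ⊗ y ⊗ y`, whose slices have rank at most one. -/
theorem Apolar.tensor_eq_zero_of_proportional {c : Fin 3 → Fin 3 → ℂ}
    (hc : ∀ w, (∀ k, quadMap c w k = 0) → w = 0) {F : Fin 3 → Fin 3 → Fin 3 → ℂ}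
    (hF : ∀ i, Apolar c (F i)) (h₁ : ∀ i j k, F i j k = F j i k) (h₂ : ∀ i j k, F i j k = F i k j)
    (y : Fin 3 → ℂ) (G : Fin 3 → Fin 3 → ℂ) (hy : ∀ i j k, F i j k = y i * G j k) :
    ∀ i j k, F i j k = 0 := by
  by_cases hy0 : ∀ i, y i = 0
  · intro i j k; rw [hy, hy0, zero_mul]
  push Not at hy0
  obtain ⟨a, ha⟩ := hy0
  obtain ⟨K, hG⟩ : ∃ K, ∀ j k, G j k = y j * y k * K := by
    refine ⟨G a a / y a ^ 2, fun j k => ?_⟩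
    have e1 : y a * G j k = y j * G a k := by rw [← hy, h₁, hy]
    have e2 : y a * G a k = y k * G a a := by rw [← hy, h₂, h₁, hy]
    field_simp
    linear_combination y a * e1 + y j * e2
  have hFa := (hF a).eq_zero_of_minors hc (h₂ a) fun i j k l => by
    simp only [hy a, hG]; ring
  intro i j k
  have := hFa j k
  rw [hy] at this ⊢
  rw [(mul_eq_zero.mp this).resolve_left ha, mul_zero]

theorem exists_binary_quadratic_root (A B C : ℂ) :
    ∃ s t : ℂ, (s ≠ 0 ∨ t ≠ 0) ∧ A * s ^ 2 + B * s * t + C * t ^ 2 = 0 := by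
  by_cases hA : A = 0
  · exact ⟨1, 0, by simp, by simp [hA]⟩
  · obtain ⟨d, hd⟩ := IsAlgClosed.exists_pow_nat_eq (B ^ 2 - 4 * A * C) (n := 2) (by norm_num)
    refine ⟨(-B + d) / (2 * A), 1, by simp, ?_⟩
    field_simp
    linear_combination hd

/-- Such a tensor is a binary cubic in disguise. Some slice in the pencil of `F e` and `F f` has
rank at most one, hence vanishes, and then all slices are proportional. -/
theorem Apolar.tensor_eq_zero_of_pivot {c : Fin 3 → Fin 3 → ℂ}
    (hc : ∀ w, (∀ k, quadMap c w k = 0) → w = 0) {F : Fin 3 → Fin 3 → Fin 3 → ℂ}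
    (hF : ∀ i, Apolar c (F i)) (h₁ : ∀ i j k, F i j k = F j i k) (h₂ : ∀ i j k, F i j k = F i k j)
    (e f : Fin 3) (P Q : Fin 3 → ℂ) (hPQ : ∀ i j k, F i j k = P i * F e j k + Q i * F f j k) :
    ∀ i j k, F i j k = 0 := by
  -- The quadratic form in `s, t` is the Hessian of the binary cubic, that is, the determinant of
  -- the restriction of `s F_e + t F_f` to the indices `e, f`.
  obtain ⟨s, t, hst, h0⟩ := exists_binary_quadratic_root
    (F e e e * F e f f - F e e f ^ 2) (F e e e * F f f f - F e e f * F e f f)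
    (F e e f * F f f f - F e f f ^ 2)
  have hM := ((hF e).smul s).add ((hF f).smul t)
  have hfe : ∀ j, F f e j = F e f j := fun j => h₁ _ _ _
  have hfee : F e f e = F e e f := h₂ _ _ _
  obtain ⟨α, γ, δ, hαδ, hexp⟩ : ∃ α γ δ : ℂ, α * δ - γ ^ 2 = 0 ∧ ∀ i j,
      s * F e i j + t * F f i j =
        P i * P j * α + (P i * Q j + Q i * P j) * γ + Q i * Q j * δ := by
    refine ⟨s * F e e e + t * F e e f, s * F e e f + t * F e f f, s * F e f f + t * F f f f,
      by linear_combination h0, ?_⟩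
    have key : ∀ r i j, F r i j = P i * P j * F r e e + (P i * Q j + Q i * P j) * F r e f +
        Q i * Q j * F r f f := by
      intro r i j
      have k1 : F r i j = P i * F r e j + Q i * F r f j := by
        rw [h₁ r i j, hPQ i r j, h₁ e r j, h₁ f r j]
      have k2 : ∀ a, F r a j = P j * F r a e + Q j * F r a f := by
        intro a
        rw [h₂ r a j, h₁ r j a, hPQ j r a, h₁ e r a, h₁ f r a, h₂ r a e, h₂ r a f]
      rw [k1, k2 e, k2 f, h₂ r f e]; ring
    intro i j
    rw [key e i j, key f i j, hfe e, hfee, hfe f]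
    ring
  have hz := hM.eq_zero_of_minors hc (fun i j => by rw [h₂ e, h₂ f]) fun i j k l => by
    simp only [hexp]
    linear_combination (P i * Q k - Q i * P k) * (P j * Q l - Q j * P l) * hαδ
  rcases hst with hs | ht
  · refine Apolar.tensor_eq_zero_of_proportional hc hF h₁ h₂ (fun i => Q i - P i * (t / s)) (F f)
      fun i j k => ?_
    rw [hPQ i]
    have := hz j k
    field_simp
    linear_combination P i * this
  · refine Apolar.tensor_eq_zero_of_proportional hc hF h₁ h₂ (fun i => P i - Q i * (s / t)) (F e)
      fun i j k => ?_
    rw [hPQ i]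
    have := hz j k
    field_simp
    linear_combination Q i * this

/-- A kernel vector with `v p ≠ 0` expresses slice `p` through the other two. -/
theorem Apolar.tensor_eq_zero_of_kernel {c : Fin 3 → Fin 3 → ℂ}
    (hc : ∀ w, (∀ k, quadMap c w k = 0) → w = 0) {F : Fin 3 → Fin 3 → Fin 3 → ℂ}
    (hF : ∀ i, Apolar c (F i)) (h₁ : ∀ i j k, F i j k = F j i k) (h₂ : ∀ i j k, F i j k = F i k j)
    {v : Fin 3 → ℂ} (hv : v ≠ 0) (h0 : ∀ j k, ∑ i, v i * F i j k = 0) :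
    ∀ i j k, F i j k = 0 := by
  obtain ⟨p, hp⟩ := Function.ne_iff.mp hv
  simp only [Pi.zero_apply] at hp
  refine Apolar.tensor_eq_zero_of_pivot hc hF h₁ h₂ (p + 1) (p + 2)
    (fun i => if i = p then -(v (p + 1) / v p) else if i = p + 1 then 1 else 0)
    (fun i => if i = p then -(v (p + 2) / v p) else if i = p + 2 then 1 else 0) fun i j k => ?_
  have := h0 j k
  rw [Fin.sum_univ_three] at this
  fin_cases p <;> fin_cases i <;> simp at hp ⊢ <;> field_simp <;> linear_combination this

/-- Over a quadratic map without nilpotents, apolar cubic tensors form a space of dimension at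
most one. -/
theorem Apolar.tensor_dependent {c : Fin 3 → Fin 3 → ℂ}
    (hc : ∀ w, (∀ k, quadMap c w k = 0) → w = 0) {F G : Fin 3 → Fin 3 → Fin 3 → ℂ}
    (hF : ∀ i, Apolar c (F i)) (hF₁ : ∀ i j k, F i j k = F j i k)
    (hF₂ : ∀ i j k, F i j k = F i k j)
    (hG : ∀ i, Apolar c (G i)) (hG₁ : ∀ i j k, G i j k = G j i k)
    (hG₂ : ∀ i j k, G i j k = G i k j) :
    ∃ a b : ℂ, (a ≠ 0 ∨ b ≠ 0) ∧ ∀ i j k, a * F i j k + b * G i j k = 0 := by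
  let M : Matrix (Fin 3) (Fin 3) ℂ := Matrix.of fun m i => F i m (m + 1)
  let N : Matrix (Fin 3) (Fin 3) ℂ := Matrix.of fun m i => G i m (m + 1)
  -- Some member of the pencil `a M + b N` is singular. For the corresponding tensor, contraction
  -- with `v` has no cross entries, so it vanishes and `v` is a kernel vector.
  obtain ⟨a, b, hab, v, hv, hker⟩ : ∃ a b : ℂ, (a ≠ 0 ∨ b ≠ 0) ∧
      ∃ v : Fin 3 → ℂ, v ≠ 0 ∧ a • M.mulVec v + b • N.mulVec v = 0 := by
    by_cases hM : M.det = 0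
    · obtain ⟨v, hv, h⟩ := Matrix.exists_mulVec_eq_zero_iff.mpr hM
      exact ⟨1, 0, by simp, v, hv, by simp [h]⟩
    · obtain ⟨μ, hμ⟩ := Module.End.exists_eigenvalue (Matrix.toLin' (M⁻¹ * N))
      obtain ⟨v, hv⟩ := hμ.exists_hasEigenvector
      refine ⟨-μ, 1, by simp, v, hv.2, ?_⟩
      have h1 := hv.apply_eq_smul
      rw [Matrix.toLin'_apply] at h1
      have h2 := congrArg M.mulVec h1
      rw [Matrix.mulVec_mulVec, ← mul_assoc, Matrix.mul_nonsing_inv _ (Ne.isUnit hM), one_mul,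
        Matrix.mulVec_smul] at h2
      rw [h2]; simp
  refine ⟨a, b, hab, ?_⟩
  have hH : ∀ i, Apolar c (fun j k => a * F i j k + b * G i j k) :=
    fun i => ((hF i).smul a).add ((hG i).smul b)
  refine Apolar.tensor_eq_zero_of_kernel hc hH (fun i j k => by rw [hF₁, hG₁])
    (fun i j k => by rw [hF₂, hG₂]) hv ?_
  have hS : Apolar c (fun j k => ∑ i, v i * (a * F i j k + b * G i j k)) := by
    simpa only [Fin.sum_univ_three] using
      (((hH 0).smul (v 0)).add ((hH 1).smul (v 1))).add ((hH 2).smul (v 2))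
  refine hS.eq_zero_of_cross (fun j k => ?_) fun m => ?_
  · exact Finset.sum_congr rfl fun i _ => by rw [hF₂, hG₂]
  · have := congrFun hker m
    simp only [M, N, Matrix.mulVec, dotProduct, Fin.sum_univ_three, Pi.add_apply, Pi.smul_apply,
      smul_eq_mul, Matrix.of_apply, Pi.zero_apply] at this
    rw [Fin.sum_univ_three]
    linear_combination this

/-- The slices `T i` are apolar cubics, hence all proportional to one nonzero `T a`. Each cubic `T
j` then has proportional slices as well. -/
theorem Apolar.quartic_eq_zero {c : Fin 3 → Fin 3 → ℂ}
    (hc : ∀ w, (∀ k, quadMap c w k = 0) → w = 0) {T : Fin 3 → Fin 3 → Fin 3 → Fin 3 → ℂ}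
    (hT : ∀ i j, Apolar c (T i j)) (h₁ : ∀ i j k l, T i j k l = T j i k l)
    (h₂ : ∀ i j k l, T i j k l = T i k j l) (h₃ : ∀ i j k l, T i j k l = T i j l k) :
    ∀ i j k l, T i j k l = 0 := by
  by_contra hne
  push Not at hne
  obtain ⟨a, j₀, k₀, l₀, hne⟩ := hne
  have hprop : ∀ i, ∃ y : ℂ, ∀ j k l, T i j k l = y * T a j k l := by
    intro i
    obtain ⟨r, s, hrs, h⟩ := Apolar.tensor_dependent hc (hT a) (h₂ a) (h₃ a) (hT i) (h₂ i) (h₃ i)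
    have hs : s ≠ 0 := by
      rintro rfl
      have := h j₀ k₀ l₀
      simp only [zero_mul, add_zero, mul_eq_zero, hne, or_false] at this
      simp [this] at hrs
    refine ⟨-r / s, fun j k l => ?_⟩
    field_simp
    linear_combination h j k l
  choose y hy using hprop
  refine hne ?_
  rw [h₁]
  exact Apolar.tensor_eq_zero_of_proportional hc (hT j₀) (h₂ j₀) (h₃ j₀) y (T a j₀)
    (fun i k l => by rw [h₁, hy]) a k₀ l₀

end QuadField

/-! ### The coordinate ring has dimension at most 8 = 1 + 3 + 3 + 1 -/

namespace QuadField

open MvPolynomial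

/-- The components of the field are `x_k² + ∑ c_{km} x_m x_{m+1}` (indices modulo 3). -/
def HasCross (β : Coeff) (c : Fin 3 → Fin 3 → ℂ) : Prop :=
  ∀ k, comp β k = quadMap (fun k m => C (c k m)) X k

theorem HasCross.field_eq {β : Coeff} {c : Fin 3 → Fin 3 → ℂ} (h : HasCross β c)
    (x : Fin 3 → ℂ) : field β x = quadMap c x := by
  funext k
  simp [field, h k, quadMap]

/-- The class of a coordinate function. -/
noncomputable def coord (β : Coeff) (i : Fin 3) : FixRing β := Ideal.Quotient.mk _ (X i)

theorem mk_C_mul (β : Coeff) (a : ℂ) (z : FixRing β) :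
    Ideal.Quotient.mk (fixIdeal β) (C a) * z = a • z := by
  obtain ⟨f, rfl⟩ := Ideal.Quotient.mk_surjective z
  rw [← map_mul, C_mul']
  rfl

theorem HasCross.coord_sq {β : Coeff} {c : Fin 3 → Fin 3 → ℂ} (h : HasCross β c) (k : Fin 3) :
    coord β k ^ 2 + ∑ m, c k m • (coord β m * coord β (m + 1)) = coord β k := by
  have := Ideal.Quotient.eq_zero_iff_mem.mpr (comp_sub_X_mem_fixIdeal β k)
  rw [h k, quadMap, map_sub, sub_eq_zero] at this
  simp only [map_add, map_pow, map_sum, map_mul] at this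
  simpa only [coord, mk_C_mul] using this

/-- Multiplying the relation for `x_k` by `f` and applying `φ` leaves only its quadratic part. -/
theorem HasCross.apolar {β : Coeff} {c : Fin 3 → Fin 3 → ℂ} (h : HasCross β c)
    (φ : Module.Dual ℂ (FixRing β)) (f : FixRing β) (h0 : ∀ k, φ (coord β k * f) = 0) :
    Apolar c (fun i j => φ (coord β i * coord β j * f)) := by
  intro k
  have := congrArg (fun z => φ (z * f)) (h.coord_sq k)
  simp only [h0, add_mul, Finset.sum_mul, map_add, map_sum, smul_mul_assoc, map_smul,
    smul_eq_mul, sq] at this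
  exact this

theorem HasCross.dual_quartic_eq_zero {β : Coeff} {c : Fin 3 → Fin 3 → ℂ} (h : HasCross β c)
    (hc : ∀ w, (∀ k, quadMap c w k = 0) → w = 0) (φ : Module.Dual ℂ (FixRing β)) (g : FixRing β)
    (h3 : ∀ i j k, φ (coord β i * (coord β j * coord β k) * g) = 0) (i j k l : Fin 3) :
    φ (coord β i * (coord β j * coord β k) * (g * coord β l)) = 0 := by
  have := Apolar.quartic_eq_zero hc
    (T := fun i j k l => φ (coord β k * coord β l * (coord β i * coord β j * g)))
    (fun i j => h.apolar φ _ fun k => (congrArg φ (by ring)).trans (h3 k i j))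
    (fun i j k l => congrArg φ (by ring)) (fun i j k l => congrArg φ (by ring))
    (fun i j k l => congrArg φ (by ring)) i j k l
  exact (congrArg φ (by ring)).trans this

/-- The functional `φ` vanishes on the products of `z` with at most three coordinates. -/
def VanishesToThree {β : Coeff} (φ : Module.Dual ℂ (FixRing β)) (z : FixRing β) : Prop :=
  φ z = 0 ∧ (∀ i, φ (coord β i * z) = 0) ∧ (∀ i j, φ (coord β i * coord β j * z) = 0) ∧
    ∀ i j k, φ (coord β i * (coord β j * coord β k) * z) = 0

theorem VanishesToThree.add {β : Coeff} {φ : Module.Dual ℂ (FixRing β)} {z w : FixRing β}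
    (hz : VanishesToThree φ z) (hw : VanishesToThree φ w) : VanishesToThree φ (z + w) := by
  obtain ⟨a0, a1, a2, a3⟩ := hz
  obtain ⟨b0, b1, b2, b3⟩ := hw
  refine ⟨?_, fun i => ?_, fun i j => ?_, fun i j k => ?_⟩
  · rw [map_add, a0, b0, add_zero]
  · rw [mul_add, map_add, a1, b1, add_zero]
  · rw [mul_add, map_add, a2, b2, add_zero]
  · rw [mul_add, map_add, a3, b3, add_zero]

theorem VanishesToThree.smul {β : Coeff} {φ : Module.Dual ℂ (FixRing β)} {z : FixRing β}
    (hz : VanishesToThree φ z) (a : ℂ) : VanishesToThree φ (a • z) := by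
  obtain ⟨a0, a1, a2, a3⟩ := hz
  refine ⟨?_, fun i => ?_, fun i j => ?_, fun i j k => ?_⟩
  · rw [map_smul, a0, smul_zero]
  · rw [mul_smul_comm, map_smul, a1, smul_zero]
  · rw [mul_smul_comm, map_smul, a2, smul_zero]
  · rw [mul_smul_comm, map_smul, a3, smul_zero]

theorem HasCross.vanishesToThree_mul_coord {β : Coeff} {c : Fin 3 → Fin 3 → ℂ}
    (h : HasCross β c) (hc : ∀ w, (∀ k, quadMap c w k = 0) → w = 0)
    {φ : Module.Dual ℂ (FixRing β)} {z : FixRing β} (hz : VanishesToThree φ z) (l : Fin 3) :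
    VanishesToThree φ (z * coord β l) := by
  obtain ⟨a0, a1, a2, a3⟩ := hz
  refine ⟨?_, fun i => ?_, fun i j => ?_, fun i j k => ?_⟩
  · exact (congrArg φ (by ring)).trans (a1 l)
  · exact (congrArg φ (by ring)).trans (a2 i l)
  · exact (congrArg φ (by ring)).trans (a3 i j l)
  · exact h.dual_quartic_eq_zero hc φ z a3 i j k l

/-- Vanishing on three consecutive-degree steps propagates: vanishing on cubic multiples makes the
quartic values an apolar tensor, hence zero. So the property passes from `z` to `z x_l` and reaches
every polynomial. -/
theorem HasCross.dual_eq_zero {β : Coeff} {c : Fin 3 → Fin 3 → ℂ} (h : HasCross β c)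
    (hc : ∀ w, (∀ k, quadMap c w k = 0) → w = 0) (φ : Module.Dual ℂ (FixRing β))
    (h1 : VanishesToThree φ 1) : φ = 0 := by
  have key : ∀ f : MvPolynomial (Fin 3) ℂ, VanishesToThree φ (Ideal.Quotient.mk _ f) := by
    intro f
    induction f using MvPolynomial.induction_on with
    | C a =>
      have := h1.smul a
      rw [← mk_C_mul, mul_one] at this
      exact this
    | add f g hf hg =>
      rw [map_add]
      exact hf.add hg
    | mul_X f l hf =>
      rw [map_mul]
      exact h.vanishesToThree_mul_coord hc hf l
  refine LinearMap.ext fun z => ?_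
  obtain ⟨f, rfl⟩ := Ideal.Quotient.mk_surjective z
  exact (key f).1

/-- Values of a functional on the classes of `1`, `x_i` and `x_m x_{m+1}`. -/
noncomputable def lowDegree (β : Coeff) :
    Module.Dual ℂ (FixRing β) →ₗ[ℂ] ℂ × (Fin 3 → ℂ) × (Fin 3 → ℂ) where
  toFun φ := (φ 1, fun i => φ (coord β i), fun m => φ (coord β m * coord β (m + 1)))
  map_add' _ _ := rfl
  map_smul' _ _ := rfl

/-- A functional in the kernel vanishes in degrees up to two, so its values on cubic monomials form
an apolar tensor. Those tensors are pairwise dependent, and the tensor determines the functional. -/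
theorem HasCross.rank_ker_lowDegree {β : Coeff} {c : Fin 3 → Fin 3 → ℂ} (h : HasCross β c)
    (hc : ∀ w, (∀ k, quadMap c w k = 0) → w = 0) :
    Module.rank ℂ (LinearMap.ker (lowDegree β)) ≤ 1 := by
  have hlow : ∀ φ ∈ LinearMap.ker (lowDegree β), φ 1 = 0 ∧ (∀ i, φ (coord β i) = 0) ∧
      ∀ i j, φ (coord β i * coord β j) = 0 := by
    intro φ hφ
    have h' : lowDegree β φ = 0 := hφ
    simp only [lowDegree, LinearMap.coe_mk, AddHom.coe_mk, Prod.mk_eq_zero] at h'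
    obtain ⟨h0, h1, h2⟩ := h'
    refine ⟨h0, congrFun h1, fun i j => ?_⟩
    have hap := h.apolar φ 1 (fun k => by rw [mul_one]; exact congrFun h1 k)
    have := hap.eq_zero_of_cross (fun i j => congrArg _ (by ring))
      (fun m => by rw [mul_one]; exact congrFun h2 m) i j
    rwa [mul_one] at this
  have htens : ∀ φ ∈ LinearMap.ker (lowDegree β),
      ∀ i, Apolar c (fun j k => φ (coord β i * (coord β j * coord β k))) := by
    intro φ hφ i
    have := h.apolar φ (coord β i) (fun k => (hlow φ hφ).2.2 k i)
    simpa only [mul_comm] using this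
  rw [rank_le_one_iff]
  by_cases hne : ∃ φ₀ : LinearMap.ker (lowDegree β), φ₀ ≠ 0
  · obtain ⟨φ₀, hφ₀⟩ := hne
    refine ⟨φ₀, fun φ => ?_⟩
    obtain ⟨a, b, hab, hd⟩ := Apolar.tensor_dependent hc (htens φ₀ φ₀.2)
      (fun i j k => congrArg _ (by ring)) (fun i j k => congrArg _ (by ring)) (htens φ φ.2)
      (fun i j k => congrArg _ (by ring)) (fun i j k => congrArg _ (by ring))
    have hz : a • φ₀ + b • φ = 0 := by
      have hm := (a • φ₀ + b • φ).2
      refine Subtype.ext (h.dual_eq_zero hc _ ⟨(hlow _ hm).1, fun i => ?_, fun i j => ?_,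
        fun i j k => ?_⟩)
      · rw [mul_one]
        exact (hlow _ hm).2.1 i
      · rw [mul_one]
        exact (hlow _ hm).2.2 i j
      · rw [mul_one]
        exact hd i j k
    have hb : b ≠ 0 := by
      rintro rfl
      simp only [zero_smul, add_zero, smul_eq_zero, hφ₀, or_false] at hz
      simp [hz] at hab
    refine ⟨-(a / b), ?_⟩
    have : φ = b⁻¹ • (b • φ) := by rw [smul_smul, inv_mul_cancel₀ hb, one_smul]
    rw [this, eq_neg_of_add_eq_zero_right hz, smul_neg, smul_smul, neg_smul]
    congr 2
    field_simp
  · push Not at hne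
    exact ⟨0, fun φ => ⟨0, by simp [hne φ]⟩⟩

theorem HasCross.finite_and_finrank_le {β : Coeff} {c : Fin 3 → Fin 3 → ℂ} (h : HasCross β c)
    (hn : ∀ w, ¬ IsNil β w) :
    Module.Finite ℂ (FixRing β) ∧ Module.finrank ℂ (FixRing β) ≤ 8 := by
  have hc : ∀ w, (∀ k, quadMap c w k = 0) → w = 0 := by
    intro w hw
    by_contra hw0
    exact hn w ⟨hw0, by rw [h.field_eq]; exact funext hw⟩
  have hrk : Module.rank ℂ (Module.Dual ℂ (FixRing β)) ≤ 8 := by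
    rw [← (lowDegree β).rank_range_add_rank_ker]
    have h1 : Module.rank ℂ (LinearMap.range (lowDegree β)) ≤ 7 := by
      refine (Submodule.rank_le _).trans ?_
      rw [← Module.finrank_eq_rank]
      simp
    calc _ ≤ (7 : Cardinal) + 1 := add_le_add h1 (h.rank_ker_lowDegree hc)
      _ = 8 := by norm_num
  have hfin : Module.Finite ℂ (Module.Dual ℂ (FixRing β)) := by
    rw [← Module.rank_lt_aleph0_iff]
    exact hrk.trans_lt (Cardinal.ofNat_lt_aleph0)
  have hfin' : Module.Finite ℂ (FixRing β) := by
    exact Module.finite_dual_iff ℂ |>.mp hfin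
  refine ⟨hfin', ?_⟩
  rw [← Subspace.dual_finrank_eq]
  have := Module.finrank_le_of_rank_le (n := 8) (by simpa using hrk)
  exact this

end QuadField

/-! ### The Euler–Jacobi relation by an elementary argument -/

namespace QuadField

open MvPolynomial

section Generic

variable {R S : Type*} [CommRing R] [CommRing S]

/-- The matrix of the products `γ_{im} γ_{i,m+1}` (indices modulo 3). -/
def crossMat (γ : Fin 3 × Fin 3 → R) : Matrix (Fin 3) (Fin 3) R :=
  Matrix.of fun i m => γ (i, m) * γ (i, m + 1)

/-- The cross coefficients of the distinguished field with parameters `γ`, multiplied by the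
determinant of `crossMat γ`. -/
def crossNum (γ : Fin 3 × Fin 3 → R) (k m : Fin 3) : R :=
  ∑ i, (crossMat γ).adjugate m i * (γ (i, k) - γ (i, k) ^ 2)

/-- The points `e_1, e_2, e_3, v_1, v_2, v_3, 0`. -/
def points (γ : Fin 3 × Fin 3 → R) : Fin 7 → Fin 3 → R :=
  ![Pi.single 0 1, Pi.single 1 1, Pi.single 2 1, fun j => γ (0, j), fun j => γ (1, j),
    fun j => γ (2, j), 0]

/-- `d` times the Jacobian matrix of `x_k² + d⁻¹ ∑ c_{km} x_m x_{m+1} - x_k`. -/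
def jacMat (d : R) (c : Fin 3 → Fin 3 → R) (x : Fin 3 → R) : Matrix (Fin 3) (Fin 3) R :=
  Matrix.of fun k l => (if k = l then d * (2 * x k - 1) else 0) +
    ∑ m, c k m * ((if m = l then x (m + 1) else 0) + (if m + 1 = l then x m else 0))

/-- A multiple of the Jacobian determinant at the `i`-th point. -/
def jacNum (γ : Fin 3 × Fin 3 → R) (i : Fin 7) : R :=
  (jacMat (crossMat γ).det (crossNum γ) (points γ i)).det

/-- Homogeneous coordinates. -/
def homog (x : Fin 3 → R) : Fin 4 → R := ![1, x 0, x 1, x 2]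

/-- The second moments of the seven points, weighted by the inverses of the Jacobian determinants,
multiplied by the product of these determinants. -/
def moment (γ : Fin 3 × Fin 3 → R) (a b : Fin 4) : R :=
  ∑ i, homog (points γ i) a * homog (points γ i) b * ∏ j ∈ Finset.univ.erase i, jacNum γ j

theorem map_crossMat (f : R →+* S) (γ : Fin 3 × Fin 3 → R) :
    (crossMat γ).map f = crossMat (f ∘ γ) := by
  ext i m
  simp [crossMat]

theorem map_det_crossMat (f : R →+* S) (γ : Fin 3 × Fin 3 → R) :
    f (crossMat γ).det = (crossMat (f ∘ γ)).det := by
  rw [← map_crossMat, RingHom.map_det]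
  rfl

theorem map_crossNum (f : R →+* S) (γ : Fin 3 × Fin 3 → R) (k m : Fin 3) :
    f (crossNum γ k m) = crossNum (f ∘ γ) k m := by
  have h : ∀ i, f ((crossMat γ).adjugate m i) = (crossMat (f ∘ γ)).adjugate m i := fun i => by
    rw [← map_crossMat]
    exact congrFun (congrFun (RingHom.map_adjugate f (crossMat γ)) m) i
  simp [crossNum, h]

theorem map_points (f : R →+* S) (γ : Fin 3 × Fin 3 → R) (i : Fin 7) (k : Fin 3) :
    f (points γ i k) = points (f ∘ γ) i k := by
  fin_cases i <;> simp [points, Pi.single_apply, apply_ite f]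

theorem map_jacNum (f : R →+* S) (γ : Fin 3 × Fin 3 → R) (i : Fin 7) :
    f (jacNum γ i) = jacNum (f ∘ γ) i := by
  rw [jacNum, RingHom.map_det, jacNum]
  congr 1
  ext k l
  simp [jacMat, map_points, map_crossNum, map_det_crossMat, apply_ite f, map_ofNat f 2]

theorem map_moment (f : R →+* S) (γ : Fin 3 × Fin 3 → R) (a b : Fin 4) :
    f (moment γ a b) = moment (f ∘ γ) a b := by
  have h : ∀ i a, f (homog (points γ i) a) = homog (points (f ∘ γ) i) a := fun i a => by
    fin_cases a <;> simp [homog, map_points]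
  simp [moment, h, map_jacNum]

end Generic

/-- For quadratic polynomials the mean value formula is exact with the derivative at the midpoint.
Hence the Jacobian is singular halfway between two solutions. -/
theorem jacMat_mulVec_sub (c : Fin 3 → Fin 3 → ℂ) (x y : Fin 3 → ℂ) :
    (jacMat 1 c (fun k => (x k + y k) / 2)).mulVec (x - y) =
      (quadMap c x - x) - (quadMap c y - y) := by
  funext k
  fin_cases k <;>
  simp [jacMat, Matrix.mulVec, dotProduct, Fin.sum_univ_three, quadMap] <;> ring

theorem det_jacMat_eq_zero {c : Fin 3 → Fin 3 → ℂ} {x y : Fin 3 → ℂ} (hx : quadMap c x = x)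
    (hy : quadMap c y = y) (hxy : x ≠ y) : (jacMat 1 c (fun k => (x k + y k) / 2)).det = 0 := by
  refine Matrix.exists_mulVec_eq_zero_iff.mp ⟨x - y, sub_ne_zero.mpr hxy, ?_⟩
  rw [jacMat_mulVec_sub, hx, hy]
  simp

/-- A functional vanishing on polynomials of degree at most two takes the same value on the
determinants of two matrices of affine functions that differ by constants. -/
theorem map_det_eq_of_sub_const {σ : Type*} (L : ((σ → ℂ) → ℂ) →ₗ[ℂ] ℂ)
    (V : Submodule ℂ ((σ → ℂ) → ℂ)) (h1 : (1 : (σ → ℂ) → ℂ) ∈ V)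
    (hL : ∀ f ∈ V, ∀ g ∈ V, L (f * g) = 0)
    (G : Fin 3 → Fin 3 → (σ → ℂ) → ℂ) (hG : ∀ k l, G k l ∈ V) (d : Fin 3 → Fin 3 → ℂ) :
    L (fun x => (Matrix.of fun k l => G k l x + d k l).det) =
      L (fun x => (Matrix.of fun k l => G k l x).det) := by
  have hG' : ∀ k l, G k l + d k l • 1 ∈ V := fun k l => V.add_mem (hG k l) (V.smul_mem _ h1)
  rw [← sub_eq_zero, ← map_sub]
  -- Replace one row at a time: in each group one row comes from `d`, the rows above it from `G` and
  -- the rows below it from `G + d`. Every term is a constant times a product of two affine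
  -- functions.
  have key : ((fun x => (Matrix.of fun k l => G k l x + d k l).det) -
      fun x => (Matrix.of fun k l => G k l x).det) =
      (d 0 0 • ((G 1 1 + d 1 1 • 1) * (G 2 2 + d 2 2 • 1)) -
        d 0 0 • ((G 1 2 + d 1 2 • 1) * (G 2 1 + d 2 1 • 1)) -
        d 0 1 • ((G 1 0 + d 1 0 • 1) * (G 2 2 + d 2 2 • 1)) +
        d 0 1 • ((G 1 2 + d 1 2 • 1) * (G 2 0 + d 2 0 • 1)) +
        d 0 2 • ((G 1 0 + d 1 0 • 1) * (G 2 1 + d 2 1 • 1)) -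
        d 0 2 • ((G 1 1 + d 1 1 • 1) * (G 2 0 + d 2 0 • 1))) +
      (d 1 1 • (G 0 0 * (G 2 2 + d 2 2 • 1)) - d 1 2 • (G 0 0 * (G 2 1 + d 2 1 • 1)) -
        d 1 0 • (G 0 1 * (G 2 2 + d 2 2 • 1)) + d 1 2 • (G 0 1 * (G 2 0 + d 2 0 • 1)) +
        d 1 0 • (G 0 2 * (G 2 1 + d 2 1 • 1)) - d 1 1 • (G 0 2 * (G 2 0 + d 2 0 • 1))) +
      (d 2 2 • (G 0 0 * G 1 1) - d 2 1 • (G 0 0 * G 1 2) - d 2 2 • (G 0 1 * G 1 0) +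
        d 2 0 • (G 0 1 * G 1 2) + d 2 1 • (G 0 2 * G 1 0) - d 2 0 • (G 0 2 * G 1 1)) := by
    funext x
    simp only [Matrix.det_fin_three, Matrix.of_apply, Pi.sub_apply, Pi.add_apply, Pi.smul_apply,
      Pi.mul_apply, Pi.one_apply, smul_eq_mul, mul_one]
    ring
  rw [key]
  simp only [map_add, map_sub, map_smul, hL _ (hG _ _) _ (hG _ _), hL _ (hG _ _) _ (hG' _ _),
    hL _ (hG' _ _) _ (hG' _ _), smul_zero, add_zero, sub_zero]

/-- Weights at the seven points for which the weighted sum of every quadratic polynomial is its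
value at `s`. -/
theorem exists_weights {γ : Fin 3 × Fin 3 → ℂ} {c : Fin 3 → Fin 3 → ℂ}
    (hA : IsUnit (crossMat γ).det) (hγ : ∀ i, quadMap c (fun j => γ (i, j)) = fun j => γ (i, j))
    {s : Fin 3 → ℂ} (hs : quadMap c s = s) :
    ∃ μ : Fin 7 → ℂ, ∀ a b,
      ∑ i, μ i * (homog (points γ i) a * homog (points γ i) b) = homog s a * homog s b := by
  obtain ⟨ν, hν⟩ : ∃ ν : Fin 3 → ℂ, ∀ m, ∑ i, ν i * (γ (i, m) * γ (i, m + 1)) =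
      s m * s (m + 1) := by
    refine ⟨Matrix.vecMul (fun m => s m * s (m + 1)) (crossMat γ)⁻¹, fun m => ?_⟩
    have h : Matrix.vecMul (Matrix.vecMul (fun m => s m * s (m + 1)) (crossMat γ)⁻¹)
        (crossMat γ) m = s m * s (m + 1) := by
      rw [Matrix.vecMul_vecMul, Matrix.nonsing_inv_mul _ hA, Matrix.vecMul_one]
    exact h
  have hν0 := hν 0
  have hν1 := hν 1
  have hν2 := hν 2
  have hsq : ∀ k, ∑ i, ν i * (γ (i, k) - γ (i, k) ^ 2) = s k - s k ^ 2 := by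
    intro k
    have h1 := congrFun hs k
    have e0 := congrFun (hγ 0) k
    have e1 := congrFun (hγ 1) k
    have e2 := congrFun (hγ 2) k
    simp only [quadMap, Fin.sum_univ_three] at *
    linear_combination ν 0 * (-e0) + ν 1 * (-e1) + ν 2 * (-e2) + h1 + c k 0 * hν0 + c k 1 * hν1
      + c k 2 * hν2
  have q0 := hsq 0
  have q1 := hsq 1
  have q2 := hsq 2
  -- The weights `ν` at the `v_i` match the cross monomials and, through the fixed point equations,
  -- `x_k - x_k²`. The weights at the `e_k` then correct the linear monomials, and the weight at `0`
  -- corrects the constant.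
  refine ⟨![s 0 - ∑ i, ν i * γ (i, 0), s 1 - ∑ i, ν i * γ (i, 1), s 2 - ∑ i, ν i * γ (i, 2),
    ν 0, ν 1, ν 2, 1 - ∑ i, ν i - ∑ k, (s k - ∑ i, ν i * γ (i, k))], fun a b => ?_⟩
  fin_cases a <;> fin_cases b <;>
    simp [Fin.sum_univ_seven, Fin.sum_univ_three, points, homog] at hν0 hν1 hν2 q0 q1 q2 ⊢ <;>
    first
    | ring1
    | linear_combination -q0
    | linear_combination -q1
    | linear_combination -q2
    | linear_combination hν0
    | linear_combination hν1
    | linear_combination hν2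

/-- Affine functions. -/
def affineFunctions : Submodule ℂ ((Fin 3 → ℂ) → ℂ) :=
  Submodule.span ℂ (Set.range fun a : Fin 4 => fun x => homog x a)

theorem one_mem_affineFunctions : (1 : (Fin 3 → ℂ) → ℂ) ∈ affineFunctions :=
  Submodule.subset_span ⟨0, rfl⟩

theorem coord_mem_affineFunctions (k : Fin 3) : (fun x : Fin 3 → ℂ => x k) ∈ affineFunctions :=
  Submodule.subset_span ⟨k.succ, by fin_cases k <;> rfl⟩

theorem map_mul_eq_zero_of_mem_affineFunctions (L : ((Fin 3 → ℂ) → ℂ) →ₗ[ℂ] ℂ)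
    (hL : ∀ a b, L (fun x => homog x a * homog x b) = 0) :
    ∀ f ∈ affineFunctions, ∀ g ∈ affineFunctions, L (f * g) = 0 := by
  intro f hf g hg
  induction hf using Submodule.span_induction with
  | mem f hf =>
    obtain ⟨a, rfl⟩ := hf
    induction hg using Submodule.span_induction with
    | mem g hg =>
      obtain ⟨b, rfl⟩ := hg
      exact hL a b
    | zero => simp
    | add g g' _ _ h h' => rw [mul_add, map_add, h, h', add_zero]
    | smul r g _ h => rw [mul_smul_comm, map_smul, h, smul_zero]
  | zero => simp
  | add f f' _ _ h h' => rw [add_mul, map_add, h, h', add_zero]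
  | smul r f _ h => rw [smul_mul_assoc, map_smul, h, smul_zero]

/-- A functional vanishing on polynomials of degree at most two does not distinguish the shifted
Jacobian determinants. -/
theorem map_det_jacMat_eq (L : ((Fin 3 → ℂ) → ℂ) →ₗ[ℂ] ℂ)
    (hL : ∀ a b, L (fun x => homog x a * homog x b) = 0) (c : Fin 3 → Fin 3 → ℂ)
    (u : Fin 3 → ℂ) :
    L (fun x => (jacMat 1 c (fun k => (x k + u k) / 2)).det) =
      L (fun x => (jacMat 1 c (fun k => x k / 2)).det) := by
  have h := map_det_eq_of_sub_const L affineFunctions one_mem_affineFunctions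
    (map_mul_eq_zero_of_mem_affineFunctions L hL)
    (fun k l x => jacMat 1 c (fun k => x k / 2) k l) (fun k l => ?_)
    (fun k l => (if k = l then u k else 0) +
      ∑ m, c k m * ((if m = l then u (m + 1) / 2 else 0) + (if m + 1 = l then u m / 2 else 0)))
  · convert h using 3 with x
    · congr 1
      ext k l
      simp only [jacMat, Matrix.of_apply, Fin.sum_univ_three]
      split_ifs <;> ring
    · rfl
  · have : (fun x : Fin 3 → ℂ => jacMat 1 c (fun k => x k / 2) k l) =
        (if k = l then (1 : ℂ) else 0) • ((fun x => x k) - 1) +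
        ∑ m, ((c k m * if m = l then 1 / 2 else 0) • (fun x : Fin 3 → ℂ => x (m + 1)) +
          (c k m * if m + 1 = l then 1 / 2 else 0) • (fun x : Fin 3 → ℂ => x m)) := by
      funext x
      simp only [jacMat, Matrix.of_apply, Fin.sum_univ_three, Pi.add_apply, Pi.smul_apply,
        Pi.sub_apply, Pi.one_apply, smul_eq_mul]
      split_ifs <;> ring
    rw [this]
    refine Submodule.add_mem _ (Submodule.smul_mem _ _ (Submodule.sub_mem _
      (coord_mem_affineFunctions k) one_mem_affineFunctions)) (Submodule.sum_mem _ fun m _ => ?_)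
    exact Submodule.add_mem _ (Submodule.smul_mem _ _ (coord_mem_affineFunctions _))
      (Submodule.smul_mem _ _ (coord_mem_affineFunctions _))

theorem jacMat_smul (d : ℂ) (c : Fin 3 → Fin 3 → ℂ) (x : Fin 3 → ℂ) :
    jacMat d (fun k m => d * c k m) x = d • jacMat 1 c x := by
  ext k l
  simp only [jacMat, Matrix.of_apply, Fin.sum_univ_three, Matrix.smul_apply, smul_eq_mul]
  split_ifs <;> ring

/-- The cross coefficients of the distinguished field with parameters `γ`. -/
theorem crossNum_eq {γ : Fin 3 × Fin 3 → ℂ} {c : Fin 3 → Fin 3 → ℂ}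
    (hγ : ∀ i, quadMap c (fun j => γ (i, j)) = fun j => γ (i, j)) (k m : Fin 3) :
    crossNum γ k m = (crossMat γ).det * c k m := by
  have h : (crossMat γ).mulVec (c k) = fun i => γ (i, k) - γ (i, k) ^ 2 := by
    funext i
    have := congrFun (hγ i) k
    simp only [quadMap] at this
    rw [eq_sub_iff_add_eq']
    refine Eq.trans ?_ this
    simp [Matrix.mulVec, dotProduct, crossMat, mul_comm]
  have h2 := congrFun (congrArg (crossMat γ).adjugate.mulVec h) m
  rw [Matrix.mulVec_mulVec, Matrix.adjugate_mul, Matrix.smul_mulVec, Matrix.one_mulVec] at h2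
  rw [crossNum]
  exact h2.symm

theorem jacNum_eq {γ : Fin 3 × Fin 3 → ℂ} {c : Fin 3 → Fin 3 → ℂ}
    (hγ : ∀ i, quadMap c (fun j => γ (i, j)) = fun j => γ (i, j)) (i : Fin 7) :
    jacNum γ i = (crossMat γ).det ^ 3 * (jacMat 1 c (points γ i)).det := by
  rw [jacNum, show crossNum γ = fun k m => (crossMat γ).det * c k m from
    funext fun k => funext fun m => crossNum_eq hγ k m, jacMat_smul, Matrix.det_smul]
  simp

theorem quadMap_points {γ : Fin 3 × Fin 3 → ℂ} {c : Fin 3 → Fin 3 → ℂ}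
    (hγ : ∀ i, quadMap c (fun j => γ (i, j)) = fun j => γ (i, j)) (i : Fin 7) :
    quadMap c (points γ i) = points γ i := by
  have h : ∀ k : Fin 3, quadMap c (Pi.single k 1) = Pi.single k 1 := fun k => by
    funext l
    fin_cases k <;> fin_cases l <;> simp [quadMap, Fin.sum_univ_three]
  have h0 : quadMap c 0 = 0 := by
    funext l
    simp [quadMap]
  fin_cases i
  exacts [h 0, h 1, h 2, hγ 0, hγ 1, hγ 2, h0]

/-- **Euler–Jacobi**: the weighted second moments have rank at most one. -/
theorem moment_eq {γ : Fin 3 × Fin 3 → ℂ} {c : Fin 3 → Fin 3 → ℂ}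
    (hA : (crossMat γ).det ≠ 0) (hγ : ∀ i, quadMap c (fun j => γ (i, j)) = fun j => γ (i, j))
    (hinj : Function.Injective (points γ)) (hJ : ∀ i, jacNum γ i ≠ 0)
    {s : Fin 3 → ℂ} (hs : quadMap c s = s) (hne : ∀ i, s ≠ points γ i) :
    ∃ κ : ℂ, ∀ a b, moment γ a b = κ * (homog s a * homog s b) := by
  obtain ⟨μ, hμ⟩ := exists_weights (Ne.isUnit hA) hγ hs
  let L : ((Fin 3 → ℂ) → ℂ) →ₗ[ℂ] ℂ :=
    ∑ i, μ i • LinearMap.proj (points γ i) - LinearMap.proj s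
  have hLapp : ∀ f, L f = ∑ i, μ i * f (points γ i) - f s := fun f => by simp [L]
  have hL : ∀ a b, L (fun x => homog x a * homog x b) = 0 := fun a b => by
    rw [hLapp, hμ, sub_self]
  have hpt := quadMap_points hγ
  have hself : ∀ u : Fin 3 → ℂ, (fun k => (u k + u k) / 2) = u := fun u => by
    funext k; ring
  -- The determinant at the midpoint of `x` and a solution vanishes at all other solutions, so `L`
  -- sees a single term. Moving the base solution changes the determinant only in degree at most
  -- two, so all these single terms agree.
  have h1 : ∀ i, L (fun x => (jacMat 1 c (fun k => (x k + points γ i k) / 2)).det) =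
      μ i * (jacMat 1 c (points γ i)).det := by
    intro i
    rw [hLapp, det_jacMat_eq_zero hs (hpt i) (hne i), sub_zero, Finset.sum_eq_single i]
    · rw [hself]
    · intro j _ hj
      rw [det_jacMat_eq_zero (hpt j) (hpt i) (hinj.ne hj), mul_zero]
    · simp
  have h2 : L (fun x => (jacMat 1 c (fun k => (x k + s k) / 2)).det) =
      -(jacMat 1 c s).det := by
    rw [hLapp, hself, Finset.sum_eq_zero, zero_sub]
    intro j _
    rw [det_jacMat_eq_zero (hpt j) hs (hne j).symm, mul_zero]
  have h3 : ∀ i, μ i * jacNum γ i = -((crossMat γ).det ^ 3 * (jacMat 1 c s).det) := by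
    intro i
    have := h1 i
    rw [map_det_jacMat_eq L hL, ← map_det_jacMat_eq L hL c s, h2] at this
    rw [jacNum_eq hγ]
    linear_combination -(crossMat γ).det ^ 3 * this
  set K := -((crossMat γ).det ^ 3 * (jacMat 1 c s).det)
  -- Otherwise all weights vanish, contradicting that they reproduce the constant 1.
  have hK : K ≠ 0 := by
    intro hK
    have hμ0 : ∀ i, μ i = 0 := fun i => by
      have := h3 i
      rw [hK] at this
      exact (mul_eq_zero.mp this).resolve_right (hJ i)
    have := hμ 0 0
    simp [hμ0, homog] at this
  refine ⟨(∏ j, jacNum γ j) / K, fun a b => ?_⟩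
  rw [← hμ a b, moment, Finset.mul_sum]
  refine Finset.sum_congr rfl fun i _ => ?_
  rw [← Finset.mul_prod_erase _ _ (Finset.mem_univ i), ← h3 i]
  have hi := hJ i
  have hmi : μ i ≠ 0 := by
    intro h0
    have := h3 i
    rw [h0, zero_mul] at this
    exact hK this.symm
  field_simp

theorem moment_mul_moment {γ : Fin 3 × Fin 3 → ℂ} {c : Fin 3 → Fin 3 → ℂ}
    (hA : (crossMat γ).det ≠ 0) (hγ : ∀ i, quadMap c (fun j => γ (i, j)) = fun j => γ (i, j))
    (hinj : Function.Injective (points γ)) (hJ : ∀ i, jacNum γ i ≠ 0)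
    {s : Fin 3 → ℂ} (hs : quadMap c s = s) (hne : ∀ i, s ≠ points γ i) (i j k l : Fin 4) :
    moment γ i j * moment γ k l = moment γ i l * moment γ k j := by
  obtain ⟨κ, h⟩ := moment_eq hA hγ hinj hJ hs hne
  simp only [h]
  ring

end QuadField

/-! ### Normal form of distinguished fields and perturbation of fixed points -/

namespace QuadField

open MvPolynomial Filter Topology

theorem sum_pairs {M : Type*} [AddCommMonoid M] (f : {ij : Fin 3 × Fin 3 // ij.1 ≤ ij.2} → M) :
    ∑ ij, f ij = f ⟨(0, 0), by decide⟩ + (f ⟨(0, 1), by decide⟩ + (f ⟨(0, 2), by decide⟩ +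
      (f ⟨(1, 1), by decide⟩ + (f ⟨(1, 2), by decide⟩ + f ⟨(2, 2), by decide⟩)))) := by
  have : (Finset.univ : Finset {ij : Fin 3 × Fin 3 // ij.1 ≤ ij.2}) =
      {⟨(0, 0), by decide⟩, ⟨(0, 1), by decide⟩, ⟨(0, 2), by decide⟩, ⟨(1, 1), by decide⟩,
        ⟨(1, 2), by decide⟩, ⟨(2, 2), by decide⟩} := by decide
  rw [this, Finset.sum_insert (by decide), Finset.sum_insert (by decide),
    Finset.sum_insert (by decide), Finset.sum_insert (by decide), Finset.sum_insert (by decide),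
    Finset.sum_singleton]

theorem field_apply (β : Coeff) (x : Fin 3 → ℂ) (k : Fin 3) :
    field β x k = ∑ ij : {ij : Fin 3 × Fin 3 // ij.1 ≤ ij.2},
      β (ij, k) * (x ij.1.1 * x ij.1.2) := by
  simp [field, comp]

/-- The structure coefficients of `x_k² + ∑ c_{km} x_m x_{m+1}`. -/
def fieldOf {R : Type*} [CommRing R] (d : R) (c : Fin 3 → Fin 3 → R) (p : CoeffIndex) : R :=
  if p.1.1.1 = p.1.1.2 then (if p.1.1.1 = p.2 then d else 0)
  else if p.1.1 = (0, 1) then c p.2 0 else if p.1.1 = (1, 2) then c p.2 1 else c p.2 2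

theorem hasCross_fieldOf (c : Fin 3 → Fin 3 → ℂ) : HasCross (fieldOf 1 c) c := by
  intro k
  rw [comp, sum_pairs, quadMap, Fin.sum_univ_three]
  fin_cases k <;> simp [fieldOf] <;> ring

/-- The cross coefficients of a field. -/
def crossCoeff (β : Coeff) (k m : Fin 3) : ℂ :=
  ![β (⟨(0, 1), by decide⟩, k), β (⟨(1, 2), by decide⟩, k), β (⟨(0, 2), by decide⟩, k)] m

theorem hasCross_of_field_single {β : Coeff}
    (h : ∀ i : Fin 3, field β (Pi.single i 1) = Pi.single i 1) : HasCross β (crossCoeff β) := by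
  have h00 : ∀ k, β (⟨(0, 0), by decide⟩, k) = if k = 0 then 1 else 0 := fun k => by
    have := congrFun (h 0) k
    rw [field_apply, sum_pairs] at this
    simpa [Pi.single_apply] using this
  have h11 : ∀ k, β (⟨(1, 1), by decide⟩, k) = if k = 1 then 1 else 0 := fun k => by
    have := congrFun (h 1) k
    rw [field_apply, sum_pairs] at this
    simpa [Pi.single_apply] using this
  have h22 : ∀ k, β (⟨(2, 2), by decide⟩, k) = if k = 2 then 1 else 0 := fun k => by
    have := congrFun (h 2) k
    rw [field_apply, sum_pairs] at this
    simpa [Pi.single_apply] using this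
  intro k
  rw [comp, sum_pairs, quadMap, Fin.sum_univ_three]
  fin_cases k <;> simp [h00, h11, h22, crossCoeff] <;> ring

theorem crossMat_eq_matA (γ : Fin 3 × Fin 3 → ℂ) : crossMat γ = matA γ := by
  ext i m
  fin_cases m <;> simp [crossMat, matA]

theorem IsDistinguishedWith.hasCross {γ : Fin 3 × Fin 3 → ℂ} {β : Coeff}
    (h : IsDistinguishedWith γ β) : HasCross β (crossCoeff β) :=
  hasCross_of_field_single fun i => (h.idem_e i).1

theorem IsDistinguishedWith.quadMap_vec {γ : Fin 3 × Fin 3 → ℂ} {β : Coeff}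
    (h : IsDistinguishedWith γ β) (i : Fin 3) :
    quadMap (crossCoeff β) (fun j => γ (i, j)) = fun j => γ (i, j) := by
  rw [← h.hasCross.field_eq]
  exact (h.idem_v i).1

theorem IsDistinguishedWith.det_ne_zero {γ : Fin 3 × Fin 3 → ℂ} {β : Coeff}
    (h : IsDistinguishedWith γ β) : (crossMat γ).det ≠ 0 := by
  rw [crossMat_eq_matA]
  exact ((Matrix.isUnit_iff_isUnit_det _).mp h.isUnit_A).ne_zero

theorem vec_ne_zero {γ : Fin 3 × Fin 3 → ℂ} (hA : (crossMat γ).det ≠ 0) (i : Fin 3) :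
    vec γ i ≠ 0 := by
  intro h
  refine hA (Matrix.det_eq_zero_of_row_eq_zero i fun m => ?_)
  have := congrFun h m
  simp only [vec, Pi.zero_apply] at this
  simp [crossMat, this]

theorem HasCross.isDistinguishedWith {γ : Fin 3 × Fin 3 → ℂ} {β : Coeff} {c : Fin 3 → Fin 3 → ℂ}
    (h : HasCross β c) (hA : (crossMat γ).det ≠ 0)
    (hγ : ∀ i, quadMap c (fun j => γ (i, j)) = fun j => γ (i, j)) :
    IsDistinguishedWith γ β where
  idem_e i := by
    refine ⟨?_, by simp⟩
    rw [h.field_eq]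
    have h3 := quadMap_points hγ
    fin_cases i
    exacts [h3 0, h3 1, h3 2]
  idem_v i := ⟨by rw [h.field_eq]; exact hγ i, vec_ne_zero hA i⟩
  isUnit_A := by
    rw [← crossMat_eq_matA, Matrix.isUnit_iff_isUnit_det]
    exact Ne.isUnit hA

/-- A distinguished field exists as soon as the matrix of products is invertible. -/
theorem quadMap_crossNum_div {γ : Fin 3 × Fin 3 → ℂ} (hA : (crossMat γ).det ≠ 0) (i : Fin 3) :
    quadMap (fun k m => crossNum γ k m / (crossMat γ).det) (fun j => γ (i, j)) =
      fun j => γ (i, j) := by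
  funext k
  have h : (crossMat γ).mulVec ((crossMat γ).adjugate.mulVec
      fun i => γ (i, k) - γ (i, k) ^ 2) i = (crossMat γ).det * (γ (i, k) - γ (i, k) ^ 2) := by
    rw [Matrix.mulVec_mulVec, Matrix.mul_adjugate, Matrix.smul_mulVec, Matrix.one_mulVec]
    rfl
  have h2 : ∑ m, crossMat γ i m * crossNum γ k m =
      (crossMat γ).det * (γ (i, k) - γ (i, k) ^ 2) := h
  have h3 : ∑ m, crossNum γ k m / (crossMat γ).det * (γ (i, m) * γ (i, m + 1)) =
      γ (i, k) - γ (i, k) ^ 2 := by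
    rw [← mul_div_cancel_left₀ (γ (i, k) - γ (i, k) ^ 2) hA, ← h2, Finset.sum_div]
    refine Finset.sum_congr rfl fun m _ => ?_
    simp only [crossMat, Matrix.of_apply]
    ring
  rw [quadMap, h3]
  ring

theorem HasCross.jac_eq {β : Coeff} {c : Fin 3 → Fin 3 → ℂ} (h : HasCross β c)
    (x : Fin 3 → ℂ) : jac β x = jacMat 1 c x := by
  ext k l
  simp only [jac, h k, quadMap, Matrix.of_apply, jacMat, Fin.sum_univ_three, map_sub, map_add,
    pderiv_mul, pderiv_pow, pderiv_C, pderiv_X, Pi.single_apply, map_mul, map_pow, eval_C, eval_X,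
    map_zero]
  fin_cases k <;> fin_cases l <;> simp <;> ring

/-- Near the field `x_k²`, a field has a fixed point near each fixed point of `x_k²`. -/
theorem eventually_exists_field_eq {u : Fin 3 → ℂ} (hu : ∀ k, u k ^ 2 = u k)
    {V : Set (Fin 3 → ℂ)} (hV : V ∈ 𝓝 u) :
    ∀ᶠ β in 𝓝 (fieldOf 1 0 : Coeff), ∃ x ∈ V, field β x = x := by
  let β₀ : Coeff := fieldOf 1 0
  have hβ₀ : ∀ x : Fin 3 → ℂ, field β₀ x = fun k => x k ^ 2 := fun x => by
    rw [(hasCross_fieldOf 0).field_eq]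
    funext k
    simp [quadMap]
  -- Carrying `β` along turns local openness of `Φ` into solvability of `field β x = x` for all
  -- nearby `β`.
  let Φ : Coeff × (Fin 3 → ℂ) → Coeff × (Fin 3 → ℂ) := fun p => (p.1, field p.1 p.2 - p.2)
  have hfield : ContDiff ℂ 1 fun p : Coeff × (Fin 3 → ℂ) => field p.1 p.2 := by
    refine contDiff_pi.mpr fun k => ?_
    simp only [field_apply]
    fun_prop
  have hΦ : ContDiff ℂ 1 Φ := contDiff_fst.prodMk (hfield.sub contDiff_snd)
  have hstrict := (hΦ.contDiffAt (x := (β₀, u))).hasStrictFDerivAt one_ne_zero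
  set D := fderiv ℂ Φ (β₀, u)
  have hfst : ∀ q, (D q).1 = q.1 := by
    intro q
    have h1 := hasFDerivAt_fst.comp (β₀, u) hstrict.hasFDerivAt
    have h2 : HasFDerivAt (Prod.fst ∘ Φ) (ContinuousLinearMap.fst ℂ Coeff (Fin 3 → ℂ)) (β₀, u) :=
      hasFDerivAt_fst
    exact congrArg (fun A => A q) (h1.unique h2)
  have hsnd : ∀ y, (D (0, y)).2 = fun k => (2 * u k - 1) * y k := by
    intro y
    have hline : HasDerivAt (fun t : ℂ => (β₀, u + t • y)) ((0 : Coeff), y) 0 := by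
      refine (hasDerivAt_const _ _).prodMk ?_
      simpa using ((hasDerivAt_id (0 : ℂ)).smul_const y).const_add u
    have hstr' : HasFDerivAt Φ D (β₀, u + (0 : ℂ) • y) := by
      simpa using hstrict.hasFDerivAt
    have h1 := hstr'.comp_hasDerivAt (0 : ℂ) hline
    funext k
    have h2 : HasDerivAt (fun t : ℂ => (Φ (β₀, u + t • y)).2 k) ((D (0, y)).2 k) 0 :=
      (hasDerivAt_pi.mp (hasFDerivAt_snd.comp_hasDerivAt (0 : ℂ) h1)) k
    have h3 : HasDerivAt (fun t : ℂ => (u k + t * y k) ^ 2 - (u k + t * y k))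
        (2 * (u k + 0 * y k) ^ 1 * y k - y k) 0 := by
      have h4 : HasDerivAt (fun t : ℂ => u k + t * y k) (y k) 0 := by
        simpa using ((hasDerivAt_id (0 : ℂ)).mul_const (y k)).const_add (u k)
      exact ((h4.pow 2).sub h4).congr_deriv (by simp)
    have h5 : (fun t : ℂ => (Φ (β₀, u + t • y)).2 k) =
        fun t : ℂ => (u k + t * y k) ^ 2 - (u k + t * y k) := by
      funext t
      simp [Φ, hβ₀]
    rw [h5] at h2
    rw [h2.unique h3]
    ring
  have hsurj : D.range = ⊤ := by
    rw [LinearMap.range_eq_top]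
    rintro ⟨b, y⟩
    -- Since `u k ^ 2 = u k`, the derivative `2 * u k - 1` is its own inverse.
    refine ⟨(b, fun k => (2 * u k - 1) * (y k - (D (b, 0)).2 k)), ?_⟩
    have : ((b, fun k => (2 * u k - 1) * (y k - (D (b, 0)).2 k)) : Coeff × (Fin 3 → ℂ)) =
        (b, 0) + (0, fun k => (2 * u k - 1) * (y k - (D (b, 0)).2 k)) := by simp
    change D _ = _
    rw [this, map_add]
    refine Prod.ext ?_ ?_
    · rw [Prod.fst_add, hfst, hfst, add_zero]
    · rw [Prod.snd_add, hsnd]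
      funext k
      simp only [Pi.add_apply]
      linear_combination 4 * (y k - (D (b, 0)).2 k) * hu k
  have hmap := hstrict.map_nhds_eq_of_surj hsurj
  have himg : Φ '' (Set.univ ×ˢ V) ∈ 𝓝 (Φ (β₀, u)) := by
    rw [← hmap]
    refine image_mem_map ?_
    rw [nhds_prod_eq]
    exact prod_mem_prod univ_mem hV
  have hΦ0 : Φ (β₀, u) = (β₀, 0) := by
    refine Prod.ext rfl ?_
    simp only [Φ, hβ₀]
    funext k
    simp [hu]
  rw [hΦ0] at himg
  have hcont : Tendsto (fun β : Coeff => (β, (0 : Fin 3 → ℂ))) (𝓝 β₀) (𝓝 (β₀, 0)) :=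
    (Continuous.prodMk_left _).tendsto _
  filter_upwards [hcont himg] with β hβ
  obtain ⟨⟨β', x⟩, ⟨_, hx⟩, he⟩ := hβ
  simp only [Φ, Prod.mk.injEq] at he
  obtain ⟨rfl, he⟩ := he
  exact ⟨x, hx, sub_eq_zero.mp he⟩

end QuadField

/-! ### The rank-one identity for the moments -/

namespace QuadField

open MvPolynomial Filter Topology

theorem eval_det_crossMat (γ : Fin 3 × Fin 3 → ℂ) :
    eval γ (crossMat (X : Fin 3 × Fin 3 → MvPolynomial (Fin 3 × Fin 3) ℂ)).det =
      (crossMat γ).det := by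
  rw [map_det_crossMat]
  congr 2
  funext p
  simp

theorem eval_crossNum (γ : Fin 3 × Fin 3 → ℂ) (k m : Fin 3) :
    eval γ (crossNum (X : Fin 3 × Fin 3 → MvPolynomial (Fin 3 × Fin 3) ℂ) k m) =
      crossNum γ k m := by
  rw [map_crossNum]
  congr 1
  funext p
  simp

theorem eval_jacNum (γ : Fin 3 × Fin 3 → ℂ) (i : Fin 7) :
    eval γ (jacNum (X : Fin 3 × Fin 3 → MvPolynomial (Fin 3 × Fin 3) ℂ) i) = jacNum γ i := by
  rw [map_jacNum]
  congr 1
  funext p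
  simp

theorem eval_moment (γ : Fin 3 × Fin 3 → ℂ) (a b : Fin 4) :
    eval γ (moment (X : Fin 3 × Fin 3 → MvPolynomial (Fin 3 × Fin 3) ℂ) a b) = moment γ a b := by
  rw [map_moment]
  congr 1
  funext p
  simp

/-- Cross monomials vanish at `0` and the `e_k`, so only the invertible `crossMat γ` is involved. -/
theorem weights_cross_eq_zero {γ : Fin 3 × Fin 3 → ℂ} (hA : (crossMat γ).det ≠ 0) {w : Fin 7 → ℂ}
    (h : ∀ m, ∑ i, w i * (points γ i m * points γ i (m + 1)) = 0) :
    w 3 = 0 ∧ w 4 = 0 ∧ w 5 = 0 := by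
  have h1 : Matrix.vecMul ![w 3, w 4, w 5] (crossMat γ) = 0 := by
    funext m
    have := h m
    simp only [Fin.sum_univ_seven] at this
    fin_cases m <;>
      simpa [points, Matrix.vecMul, dotProduct, Fin.sum_univ_three, crossMat] using this
  have h2 := Matrix.eq_zero_of_vecMul_eq_zero hA h1
  exact ⟨congrFun h2 0, congrFun h2 1, congrFun h2 2⟩

/-- Evaluations at the seven points are independent on polynomials of degree two: cross monomials
remove the `v_i`, linear ones the `e_k`, and the constant removes `0`. -/
theorem weights_eq_zero {γ : Fin 3 × Fin 3 → ℂ} (hA : (crossMat γ).det ≠ 0) {w : Fin 7 → ℂ}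
    (h : ∀ a b, ∑ i, w i * (homog (points γ i) a * homog (points γ i) b) = 0) : w = 0 := by
  obtain ⟨h3, h4, h5⟩ := weights_cross_eq_zero hA (w := w) fun m => by
    fin_cases m
    exacts [h 1 2, h 2 3, h 3 1]
  have e0 := h 0 1
  have e1 := h 0 2
  have e2 := h 0 3
  have e6 := h 0 0
  simp [Fin.sum_univ_seven, h3, h4, h5, points, homog] at e0 e1 e2 e6
  simp only [e0, e1, e2, zero_add] at e6
  funext i
  fin_cases i <;> assumption

theorem points_injective {γ : Fin 3 × Fin 3 → ℂ} (hA : (crossMat γ).det ≠ 0) :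
    Function.Injective (points γ) := by
  intro i j hij
  by_contra hne
  have := weights_eq_zero hA (w := Pi.single i 1 - Pi.single j 1) fun a b => by
    simp [sub_mul, Finset.sum_sub_distrib, Pi.single_apply, hij]
  have := congrFun this i
  simp [hne] at this

/-- The parameters `(1,1,0), (0,1,1), (1,0,1)`. -/
def baseParam {R : Type*} [CommRing R] (p : Fin 3 × Fin 3) : R := if p.2 = p.1 + 2 then 0 else 1

theorem crossMat_baseParam {R : Type*} [CommRing R] :
    crossMat (baseParam : Fin 3 × Fin 3 → R) = 1 := by
  ext i m
  fin_cases i <;> fin_cases m <;> simp [crossMat, baseParam]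

theorem crossNum_baseParam {R : Type*} [CommRing R] :
    crossNum (baseParam : Fin 3 × Fin 3 → R) = 0 := by
  funext k m
  refine Finset.sum_eq_zero fun i _ => ?_
  rw [baseParam]
  split_ifs <;> simp

theorem points_baseParam_sq (i : Fin 7) (k : Fin 3) :
    points (baseParam : Fin 3 × Fin 3 → ℂ) i k ^ 2 = points baseParam i k := by
  fin_cases i <;> fin_cases k <;> simp [points, baseParam]

theorem exists_points_baseParam_eq_zero (i : Fin 7) :
    ∃ k, points (baseParam : Fin 3 × Fin 3 → ℂ) i k = 0 := by
  fin_cases i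
  exacts [⟨1, by simp [points]⟩, ⟨2, by simp [points]⟩, ⟨0, by simp [points]⟩,
    ⟨2, by simp [points, baseParam]⟩, ⟨0, by simp [points, baseParam]⟩,
    ⟨1, by simp [points, baseParam]⟩, ⟨0, by simp [points]⟩]

theorem jacNum_baseParam_ne_zero (i : Fin 7) :
    jacNum (baseParam : Fin 3 × Fin 3 → ℂ) i ≠ 0 := by
  have h : jacMat (1 : ℂ) 0 (points baseParam i) =
      Matrix.diagonal fun k => 2 * points baseParam i k - 1 := by
    ext k l
    by_cases hkl : k = l
    · subst hkl
      simp [jacMat]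
    · simp [jacMat, hkl]
  rw [jacNum, crossMat_baseParam, crossNum_baseParam, Matrix.det_one, h, Matrix.det_diagonal,
    Finset.prod_ne_zero_iff]
  intro k _ h0
  have h1 := points_baseParam_sq i k
  have h2 : points (baseParam : Fin 3 × Fin 3 → ℂ) i k = 1 / 2 := by linear_combination h0 / 2
  rw [h2] at h1
  norm_num at h1

theorem tendsto_fieldOf_crossNum :
    Tendsto (fun γ : Fin 3 × Fin 3 → ℂ =>
        (fieldOf 1 fun k m => crossNum γ k m / (crossMat γ).det : Coeff))
      (𝓝 baseParam) (𝓝 (fieldOf 1 0)) := by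
  have h : ∀ k m, Tendsto (fun γ : Fin 3 × Fin 3 → ℂ => crossNum γ k m / (crossMat γ).det)
      (𝓝 baseParam) (𝓝 0) := by
    intro k m
    have h1 : Continuous fun γ : Fin 3 × Fin 3 → ℂ => crossNum γ k m := by
      simp only [← eval_crossNum]
      exact MvPolynomial.continuous_eval _
    have h2 : Continuous fun γ : Fin 3 × Fin 3 → ℂ => (crossMat γ).det := by
      simp only [← eval_det_crossMat]
      exact MvPolynomial.continuous_eval _
    have h3 := (h1.tendsto baseParam).div (h2.tendsto baseParam)
      (by rw [crossMat_baseParam, Matrix.det_one]; exact one_ne_zero)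
    rw [crossNum_baseParam] at h3
    simp only [Pi.zero_apply, zero_div] at h3
    exact h3
  refine tendsto_pi_nhds.mpr fun p => ?_
  simp only [fieldOf]
  split_ifs
  · exact tendsto_const_nhds
  · exact tendsto_const_nhds
  · exact h _ _
  · exact h _ _
  · exact h _ _

/-- The weighted second moments of the seven points have rank at most one. -/
theorem moment_minors (γ : Fin 3 × Fin 3 → ℂ) (i j k l : Fin 4) :
    moment γ i j * moment γ k l = moment γ i l * moment γ k j := by
  let F : MvPolynomial (Fin 3 × Fin 3) ℂ :=
    moment X i j * moment X k l - moment X i l * moment X k j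
  suffices hF : F = 0 by
    have := congrArg (eval γ) hF
    simp only [F, map_sub, map_mul, eval_moment, map_zero] at this
    exact sub_eq_zero.mp this
  refine eq_zero_of_eventually_eval_eq_zero F baseParam ?_
  have h1 : ∀ᶠ γ : Fin 3 × Fin 3 → ℂ in 𝓝 baseParam, (crossMat γ).det ≠ 0 := by
    simp only [← eval_det_crossMat]
    refine (MvPolynomial.continuous_eval _).continuousAt.eventually_ne ?_
    rw [eval_det_crossMat, crossMat_baseParam, Matrix.det_one]
    exact one_ne_zero
  have h2 : ∀ᶠ γ : Fin 3 × Fin 3 → ℂ in 𝓝 baseParam, ∀ i, jacNum γ i ≠ 0 := by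
    refine eventually_all.mpr fun i => ?_
    simp only [← eval_jacNum]
    refine (MvPolynomial.continuous_eval _).continuousAt.eventually_ne ?_
    rw [eval_jacNum]
    exact jacNum_baseParam_ne_zero i
  have h3 := tendsto_fieldOf_crossNum.eventually (eventually_exists_field_eq
    (u := fun _ => 1) (by simp) (Metric.ball_mem_nhds _ (by norm_num : (0 : ℝ) < 1 / 2)))
  have h4 : ∀ᶠ γ : Fin 3 × Fin 3 → ℂ in 𝓝 baseParam,
      ∀ i, points γ i ∈ Metric.ball (points baseParam i) (1 / 2) := by
    refine eventually_all.mpr fun i => ?_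
    have hc : Continuous fun γ : Fin 3 × Fin 3 → ℂ => points γ i := by
      fin_cases i <;> simp [points] <;> fun_prop
    exact hc.continuousAt.eventually (Metric.ball_mem_nhds _ (by norm_num : (0 : ℝ) < 1 / 2))
  filter_upwards [h1, h2, h3, h4] with γ hA hJ ⟨s, hsV, hs⟩ hpt
  rw [(hasCross_fieldOf _).field_eq] at hs
  simp only [F, map_sub, map_mul, eval_moment]
  rw [sub_eq_zero]
  refine moment_mul_moment hA (quadMap_crossNum_div hA) (points_injective hA) hJ hs
    (fun a ha => ?_) i j k l
  -- At `baseParam` the field is `x_k²`, with the 0-1 vectors as fixed points. All but `(1,1,1)`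
  -- have a zero coordinate, so balls of radius 1/2 separate the new solution from the known ones.
  obtain ⟨k, hk⟩ := exists_points_baseParam_eq_zero a
  have d1 := lt_of_le_of_lt (dist_le_pi_dist _ _ k) (Metric.mem_ball.mp hsV)
  have d2 := lt_of_le_of_lt (dist_le_pi_dist _ _ k) (Metric.mem_ball.mp (hpt a))
  rw [ha] at d1
  rw [hk] at d2
  have := dist_triangle (1 : ℂ) (points γ a k) 0
  rw [dist_comm (1 : ℂ) (points γ a k)] at this
  have h1 : dist (1 : ℂ) 0 = 1 := by simp
  linarith

end QuadField

/-! ### The seventh idempotent from the moments -/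

namespace QuadField

open MvPolynomial

/-- The candidate for the seventh idempotent. -/
noncomputable def seventh (γ : Fin 3 × Fin 3 → ℂ) (k : Fin 3) : ℂ :=
  moment γ 0 k.succ / moment γ 0 0

/-- The solution `0` is always simple, so the seventh idempotent cannot collapse onto it. -/
theorem jacNum_six (γ : Fin 3 × Fin 3 → ℂ) : jacNum γ 6 = -(crossMat γ).det ^ 3 := by
  have h : jacMat (crossMat γ).det (crossNum γ) (points γ 6) =
      Matrix.diagonal fun _ => -(crossMat γ).det := by
    ext k l
    by_cases hkl : k = l
    · subst hkl
      simp [jacMat, points]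
    · simp [jacMat, points, hkl]
  rw [jacNum, h, Matrix.det_diagonal]
  simp
  ring

/-- The weighted sum of the fixed point equations over the seven points. -/
theorem moment_apolar {γ : Fin 3 × Fin 3 → ℂ} {c : Fin 3 → Fin 3 → ℂ}
    (hγ : ∀ i, quadMap c (fun j => γ (i, j)) = fun j => γ (i, j)) (k : Fin 3) :
    moment γ k.succ k.succ + ∑ m : Fin 3, c k m * moment γ m.succ (m + 1).succ =
      moment γ 0 k.succ := by
  simp only [moment, Finset.mul_sum]
  rw [Finset.sum_comm, ← Finset.sum_add_distrib]
  refine Finset.sum_congr rfl fun i _ => ?_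
  have h := congrFun (quadMap_points hγ i) k
  have hh : ∀ k : Fin 3, homog (points γ i) k.succ = points γ i k := fun k => by
    fin_cases k <;> rfl
  have h0 : homog (points γ i) 0 = 1 := rfl
  simp only [hh, h0, one_mul]
  conv_rhs => rw [← h, quadMap, add_mul, Finset.sum_mul, sq]
  congr 1
  exact Finset.sum_congr rfl fun m _ => by ring

theorem prod_erase_jacNum_ne_zero {γ : Fin 3 × Fin 3 → ℂ} (hJ : ∀ i, jacNum γ i ≠ 0)
    (i : Fin 7) : ∏ j ∈ Finset.univ.erase i, jacNum γ j ≠ 0 :=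
  Finset.prod_ne_zero_iff.mpr fun j _ => hJ j

/-- If the corner entry vanished, the minors would kill the first row, and the remaining block would
be apolar of rank at most one, hence zero. The weights at the `v_i` would then vanish.
Geometrically, the eighth solution would be a nilpotent at infinity. -/
theorem moment_zero_ne_zero {γ : Fin 3 × Fin 3 → ℂ} {c : Fin 3 → Fin 3 → ℂ}
    (hA : (crossMat γ).det ≠ 0) (hγ : ∀ i, quadMap c (fun j => γ (i, j)) = fun j => γ (i, j))
    (hc : ∀ w, (∀ k, quadMap c w k = 0) → w = 0) (hJ : ∀ i, jacNum γ i ≠ 0) :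
    moment γ 0 0 ≠ 0 := by
  intro h0
  have hsymm : ∀ a b, moment γ a b = moment γ b a := fun a b => by
    simp only [moment, mul_comm (homog _ a)]
  have hN : ∀ k : Fin 3, moment γ 0 k.succ = 0 := fun k => by
    have := moment_minors γ 0 k.succ k.succ 0
    rw [h0, zero_mul, hsymm k.succ 0] at this
    exact mul_self_eq_zero.mp this
  have hap : Apolar c fun i j => moment γ i.succ j.succ := fun k => by
    rw [moment_apolar hγ, hN]
  have hz := hap.eq_zero_of_minors hc (fun i j => hsymm _ _) fun i j k l => moment_minors γ _ _ _ _
  have := (weights_cross_eq_zero hA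
    (w := fun i => ∏ j ∈ Finset.univ.erase i, jacNum γ j) fun m => ?_).1
  · exact prod_erase_jacNum_ne_zero hJ 3 this
  · rw [← hz m (m + 1), moment]
    refine Finset.sum_congr rfl fun i _ => ?_
    have hh : ∀ k : Fin 3, homog (points γ i) k.succ = points γ i k := fun k => by
      fin_cases k <;> rfl
    rw [hh, hh]
    ring

theorem moment_eq_seventh {γ : Fin 3 × Fin 3 → ℂ} (h0 : moment γ 0 0 ≠ 0) (a b : Fin 4) :
    moment γ a b = moment γ 0 0 * (homog (seventh γ) a * homog (seventh γ) b) := by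
  have hsymm : ∀ a b, moment γ a b = moment γ b a := fun a b => by
    simp only [moment, mul_comm (homog _ a)]
  have h1 : ∀ a, homog (seventh γ) a = moment γ 0 a / moment γ 0 0 := fun a => by
    fin_cases a
    · simp [homog, h0]
    all_goals rfl
  have := moment_minors γ 0 0 a b
  rw [hsymm a 0] at this
  rw [h1, h1]
  field_simp
  linear_combination this

theorem quadMap_seventh {γ : Fin 3 × Fin 3 → ℂ} {c : Fin 3 → Fin 3 → ℂ}
    (hγ : ∀ i, quadMap c (fun j => γ (i, j)) = fun j => γ (i, j)) (h0 : moment γ 0 0 ≠ 0) :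
    quadMap c (seventh γ) = seventh γ := by
  funext k
  have h := moment_apolar hγ k
  have hh : ∀ k : Fin 3, homog (seventh γ) k.succ = seventh γ k := fun k => by
    fin_cases k <;> rfl
  have hz : homog (seventh γ) 0 = 1 := rfl
  simp only [moment_eq_seventh h0 _ (Fin.succ _), hh, hz] at h
  refine mul_left_cancel₀ h0 ?_
  rw [quadMap, Fin.sum_univ_three]
  rw [Fin.sum_univ_three] at h
  linear_combination h

/-- Equality would give a dependence between the seven evaluations in which the weights of the other
points are nonzero. -/
theorem seventh_ne_points {γ : Fin 3 × Fin 3 → ℂ} (hA : (crossMat γ).det ≠ 0)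
    (hJ : ∀ i, jacNum γ i ≠ 0) (h0 : moment γ 0 0 ≠ 0) (i : Fin 7) : seventh γ ≠ points γ i := by
  intro hi
  have := weights_eq_zero hA (w := fun l => ∏ j ∈ Finset.univ.erase l, jacNum γ j -
    if l = i then moment γ 0 0 else 0) fun a b => by
      simp only [sub_mul, Finset.sum_sub_distrib, ite_mul, zero_mul, Finset.sum_ite_eq',
        Finset.mem_univ, if_true]
      rw [← hi, ← moment_eq_seventh h0, moment, sub_eq_zero]
      exact Finset.sum_congr rfl fun l _ => by ring
  obtain ⟨l, hl⟩ : ∃ l : Fin 7, l ≠ i := exists_ne i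
  have h := congrFun this l
  simp only [hl, if_false, sub_zero, Pi.zero_apply] at h
  exact prod_erase_jacNum_ne_zero hJ l h

/-- If exactly one Jacobian determinant vanishes, the seventh idempotent is that point. -/
theorem seventh_eq_points {γ : Fin 3 × Fin 3 → ℂ} {i : Fin 7} (hi : jacNum γ i = 0)
    (hJ : ∀ j, j ≠ i → jacNum γ j ≠ 0) : moment γ 0 0 ≠ 0 ∧ seventh γ = points γ i := by
  have h : ∀ a b, moment γ a b = homog (points γ i) a * homog (points γ i) b *
      ∏ j ∈ Finset.univ.erase i, jacNum γ j := fun a b => by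
    rw [moment, Finset.sum_eq_single i]
    · intro l _ hl
      rw [Finset.prod_eq_zero (Finset.mem_erase.mpr ⟨hl.symm, Finset.mem_univ i⟩) hi, mul_zero]
    · simp
  have hP : ∏ j ∈ Finset.univ.erase i, jacNum γ j ≠ 0 :=
    Finset.prod_ne_zero_iff.mpr fun j hj => hJ j (Finset.ne_of_mem_erase hj)
  have h00 : moment γ 0 0 = ∏ j ∈ Finset.univ.erase i, jacNum γ j := by
    rw [h]
    simp [homog]
  refine ⟨by rwa [h00], funext fun k => ?_⟩
  rw [seventh, h00, h, mul_div_assoc, div_self hP, mul_one]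
  fin_cases k <;> simp [homog]

open Classical in
/-- One if the points agree, zero otherwise. -/
noncomputable def hit {E : Type*} (x w : E) : ℕ := if x = w then 1 else 0

theorem hit_self {E : Type*} (x : E) : hit x x = 1 := if_pos rfl

theorem hit_of_ne {E : Type*} {x w : E} (h : x ≠ w) : hit x w = 0 := if_neg h

/-- If the fibres of a finite family are bounded by a positive weight whose total is at most the
size of the family, then the weight counts the fibres and is supported on the family. -/
theorem count_of_sum_le {E ι : Type*} [Fintype ι] (P : E → Prop) (m : E → ℕ)
    (l : ι → E) (hl : ∀ i, P (l i)) (hpos : ∀ w, P w → 0 < m w)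
    (hsum : ∀ Z : Finset E, (∀ w ∈ Z, P w) → ∑ w ∈ Z, m w ≤ Fintype.card ι)
    (hle : ∀ i, ∑ j, hit (l j) (l i) ≤ m (l i)) {w : E} (hw : P w) :
    m w = ∑ j, hit (l j) w := by
  classical
  set Z := Finset.univ.image l
  have hZ : ∀ w ∈ Z, P w := fun w hw => by
    obtain ⟨i, -, rfl⟩ := Finset.mem_image.mp hw
    exact hl i
  have hcard : ∑ w ∈ Z, ∑ j, hit (l j) w = Fintype.card ι := by
    rw [Finset.sum_comm, Fintype.card_eq_sum_ones]
    refine Finset.sum_congr rfl fun j _ => ?_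
    simp [hit, Z]
  have hle' : ∀ w ∈ Z, ∑ j, hit (l j) w ≤ m w := fun w hw => by
    obtain ⟨i, -, rfl⟩ := Finset.mem_image.mp hw
    exact hle i
  have heq : ∑ w ∈ Z, ∑ j, hit (l j) w = ∑ w ∈ Z, m w :=
    le_antisymm (Finset.sum_le_sum hle') (hcard ▸ hsum Z hZ)
  by_cases hwZ : w ∈ Z
  · exact ((Finset.sum_eq_sum_iff_of_le hle').mp heq w hwZ).symm
  · have h1 := hsum (insert w Z) fun v hv => by
      rcases Finset.mem_insert.mp hv with rfl | hv
      exacts [hw, hZ v hv]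
    rw [Finset.sum_insert hwZ, ← heq, hcard] at h1
    have := hpos w hw
    omega

end QuadField

/-! ### Counting idempotents with multiplicity -/

namespace QuadField

open MvPolynomial

theorem seven_eq (γ : Fin 3 × Fin 3 → ℂ) (s : Fin 3 → ℂ) (i : Fin 7) :
    seven γ s i = if i = 6 then s else points γ i := by
  fin_cases i <;> rfl

/-- The points `s, e_1, e_2, e_3, v_1, v_2, v_3, 0`. -/
def eight (γ : Fin 3 × Fin 3 → ℂ) (s : Fin 3 → ℂ) (j : Option (Fin 7)) : Fin 3 → ℂ :=
  j.elim s (points γ)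

theorem eight_none (γ : Fin 3 × Fin 3 → ℂ) (s : Fin 3 → ℂ) : eight γ s none = s := rfl

theorem eight_some (γ : Fin 3 × Fin 3 → ℂ) (s : Fin 3 → ℂ) (i : Fin 7) :
    eight γ s (some i) = points γ i := rfl

theorem seven_count (γ : Fin 3 × Fin 3 → ℂ) (s : Fin 3 → ℂ) {w : Fin 3 → ℂ} (hw : w ≠ 0) :
    Nat.card {i : Fin 7 // seven γ s i = w} =
      ∑ j : Option (Fin 7), hit (eight γ s j) w := by
  classical
  have h1 : Nat.card {i : Fin 7 // seven γ s i = w} = ∑ i, hit (seven γ s i) w := by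
    rw [Nat.card_eq_fintype_card, Fintype.card_subtype, Finset.card_filter]
    refine Finset.sum_congr rfl fun i _ => ?_
    unfold hit
    congr
  have h6 : hit (points γ 6) w = 0 := hit_of_ne hw.symm
  rw [h1, Fintype.sum_option, eight_none]
  simp only [Fin.sum_univ_seven, eight_some, h6]
  simp [seven_eq]
  ring

/-- The numerators and denominators of the seventh idempotent, as polynomials. -/
noncomputable def seventhNum (k : Fin 3) : MvPolynomial (Fin 3 × Fin 3) ℂ := moment X 0 k.succ

/-- The common denominator of the coordinates of the seventh idempotent. -/
noncomputable def seventhDen (_ : Fin 3) : MvPolynomial (Fin 3 × Fin 3) ℂ := moment X 0 0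

theorem ratPoint_seventh (γ : Fin 3 × Fin 3 → ℂ) :
    ratPoint seventhNum seventhDen γ = seventh γ := by
  funext k
  simp only [ratPoint, seventhNum, seventhDen, eval_moment, seventh]

section NoNilpotent

variable {γ : Fin 3 × Fin 3 → ℂ} {β : Coeff}

theorem IsDistinguishedWith.jacNum_eq_det_jac (h : IsDistinguishedWith γ β) (i : Fin 7) :
    jacNum γ i = (crossMat γ).det ^ 3 * (jac β (points γ i)).det := by
  rw [jacNum_eq h.quadMap_vec, h.hasCross.jac_eq]

theorem IsDistinguishedWith.field_points (h : IsDistinguishedWith γ β) (i : Fin 7) :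
    field β (points γ i) = points γ i := by
  rw [h.hasCross.field_eq]
  exact quadMap_points h.quadMap_vec i

theorem IsDistinguishedWith.two_le_mult_points (h : IsDistinguishedWith γ β)
    (hn : ∀ w, ¬ IsNil β w) {i : Fin 7} (hi : jacNum γ i = 0) : 2 ≤ mult β (points γ i) := by
  have := (h.hasCross.finite_and_finrank_le hn).1
  have h1 := mult_pos (h.field_points i)
  have h2 : mult β (points γ i) ≠ 1 := by
    refine mult_ne_one (h.field_points i) ?_
    rw [h.jacNum_eq_det_jac] at hi
    exact (mul_eq_zero.mp hi).resolve_left (pow_ne_zero _ h.det_ne_zero)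
  omega

theorem IsDistinguishedWith.sum_mult_le (h : IsDistinguishedWith γ β)
    (hn : ∀ w, ¬ IsNil β w) (Z : Finset (Fin 3 → ℂ)) (hZ : ∀ w ∈ Z, field β w = w) :
    ∑ w ∈ Z, mult β w ≤ 8 := by
  obtain ⟨h1, h2⟩ := h.hasCross.finite_and_finrank_le hn
  exact (sum_mult_le_finrank Z hZ).trans h2

/-- Two degenerate points among the seven would give total multiplicity at least 9. -/
theorem IsDistinguishedWith.jacNum_ne_zero_of_ne (h : IsDistinguishedWith γ β)
    (hn : ∀ w, ¬ IsNil β w) {i : Fin 7} (hi : jacNum γ i = 0) {j : Fin 7} (hij : j ≠ i) :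
    jacNum γ j ≠ 0 := by
  classical
  intro hj
  have := (h.hasCross.finite_and_finrank_le hn).1
  have h8 := h.sum_mult_le hn (Finset.univ.image (points γ)) fun w hw => by
    obtain ⟨i, -, rfl⟩ := Finset.mem_image.mp hw
    exact h.field_points i
  rw [Finset.sum_image (points_injective h.det_ne_zero).injOn] at h8
  have h9 : ∑ l : Fin 7, (1 + (if l = i then 1 else 0) + (if l = j then 1 else 0)) ≤
      ∑ l, mult β (points γ l) := by
    refine Finset.sum_le_sum fun l _ => ?_
    by_cases hli : l = i
    · subst hli
      simpa [hij.symm] using h.two_le_mult_points hn hi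
    · by_cases hlj : l = j
      · subst hlj
        simpa [hli] using h.two_le_mult_points hn hj
      · simpa [hli, hlj] using Nat.succ_le_of_lt (mult_pos (h.field_points l))
  simp [Finset.sum_add_distrib] at h9
  omega

theorem IsDistinguishedWith.no_quadMap_zero (h : IsDistinguishedWith γ β)
    (hn : ∀ w, ¬ IsNil β w) : ∀ w, (∀ k, quadMap (crossCoeff β) w k = 0) → w = 0 := by
  intro w hw
  by_contra hw0
  exact hn w ⟨hw0, by rw [h.hasCross.field_eq]; exact funext hw⟩

/-- Either the seventh idempotent is a new solution and all Jacobian determinants are nonzero,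
or it is the unique point where the Jacobian determinant vanishes. -/
theorem IsDistinguishedWith.seventh_cases (h : IsDistinguishedWith γ β)
    (hn : ∀ w, ¬ IsNil β w) : moment γ 0 0 ≠ 0 ∧
      ((∀ i, seventh γ ≠ points γ i) ∧ (∀ i, jacNum γ i ≠ 0) ∨
        ∃ i, seventh γ = points γ i ∧ jacNum γ i = 0) := by
  by_cases hJ : ∀ i, jacNum γ i ≠ 0
  · have h0 := moment_zero_ne_zero h.det_ne_zero h.quadMap_vec (h.no_quadMap_zero hn) hJ
    exact ⟨h0, Or.inl ⟨seventh_ne_points h.det_ne_zero hJ h0, hJ⟩⟩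
  · push Not at hJ
    obtain ⟨i, hi⟩ := hJ
    have := seventh_eq_points hi fun j hj => h.jacNum_ne_zero_of_ne hn hi hj
    exact ⟨this.1, Or.inr ⟨i, this.2, hi⟩⟩

theorem IsDistinguishedWith.seventh_ne_zero (h : IsDistinguishedWith γ β)
    (hn : ∀ w, ¬ IsNil β w) : seventh γ ≠ 0 := by
  have h6 : points γ 6 = 0 := rfl
  obtain ⟨-, ⟨hs, -⟩ | ⟨i, hi, hJ⟩⟩ := h.seventh_cases hn
  · exact h6 ▸ hs 6
  · rw [hi, ← h6]
    refine (points_injective h.det_ne_zero).ne fun hi6 => ?_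
    rw [hi6, jacNum_six] at hJ
    exact pow_ne_zero 3 h.det_ne_zero (neg_eq_zero.mp hJ)

/-- With `0` and the seventh idempotent included, the list has eight members, which equals the bound
on the total multiplicity. A repeated member is a degenerate point, so multiplicities are at least
the numbers of occurrences, and `count_of_sum_le` gives equality. -/
theorem IsDistinguishedWith.mult_eq_count (h : IsDistinguishedWith γ β)
    (hn : ∀ w, ¬ IsNil β w) {w : Fin 3 → ℂ} (hw : field β w = w) :
    mult β w = ∑ j : Option (Fin 7), hit (eight γ (seventh γ) j) w := by
  classical
  have hfin := (h.hasCross.finite_and_finrank_le hn).1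
  have hinj := points_injective h.det_ne_zero
  obtain ⟨h0, hcases⟩ := h.seventh_cases hn
  have hz : ∀ j : Option (Fin 7), field β (eight γ (seventh γ) j) =
      eight γ (seventh γ) j := by
    rintro (_ | i)
    · rw [eight_none, h.hasCross.field_eq]
      exact quadMap_seventh h.quadMap_vec h0
    · exact h.field_points i
  have hone : ∀ i, ∑ x : Fin 7, hit (points γ x) (points γ i) = 1 := fun i => by
    rw [Finset.sum_eq_single i, hit_self]
    · exact fun x _ hx => hit_of_ne (hinj.ne hx)
    · simp
  refine count_of_sum_le (fun w => field β w = w) (mult β)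
    (eight γ (seventh γ)) hz (fun w hw => mult_pos hw)
    (fun Z hZ => by simpa using h.sum_mult_le hn Z hZ) ?_ hw
  rintro (_ | i)
  · rw [Fintype.sum_option]
    simp only [eight_none, eight_some, hit_self]
    rcases hcases with ⟨hs, -⟩ | ⟨i, hi, hJ⟩
    · rw [Finset.sum_eq_zero fun i _ => hit_of_ne (hs i).symm]
      exact mult_pos (hz none)
    · rw [hi, hone]
      exact h.two_le_mult_points hn hJ
  · rw [Fintype.sum_option]
    simp only [eight_none, eight_some]
    rw [hone]
    by_cases hsi : seventh γ = points γ i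
    · rcases hcases with ⟨hs, -⟩ | ⟨i', hi', hJ⟩
      · exact absurd hsi (hs i)
      · rw [hsi, hit_self]
        have : i = i' := hinj (hsi.symm.trans hi')
        subst this
        exact h.two_le_mult_points hn hJ
    · rw [hit_of_ne hsi]
      exact mult_pos (h.field_points i)

theorem IsDistinguishedWith.mult_eq_card (h : IsDistinguishedWith γ β)
    (hn : ∀ w, ¬ IsNil β w) {w : Fin 3 → ℂ} (hw : IsIdem β w) :
    mult β w = Nat.card {i : Fin 7 // seven γ (seventh γ) i = w} := by
  rw [seven_count γ _ hw.2, h.mult_eq_count hn hw.1]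

theorem IsDistinguishedWith.isIdem_iff (h : IsDistinguishedWith γ β)
    (hn : ∀ w, ¬ IsNil β w) (w : Fin 3 → ℂ) :
    IsIdem β w ↔ ∃ i, seven γ (seventh γ) i = w := by
  have hfin := (h.hasCross.finite_and_finrank_le hn).1
  constructor
  · intro hw
    have h1 := mult_pos hw.1
    rw [h.mult_eq_card hn hw] at h1
    obtain ⟨⟨i, hi⟩⟩ := (Nat.card_pos_iff.mp h1).1
    exact ⟨i, hi⟩
  · rintro ⟨i, rfl⟩
    rw [seven_eq]
    split_ifs with hi
    · refine ⟨?_, h.seventh_ne_zero hn⟩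
      rw [h.hasCross.field_eq]
      exact quadMap_seventh h.quadMap_vec (h.seventh_cases hn).1
    · exact ⟨h.field_points i, (points_injective h.det_ne_zero).ne hi⟩

theorem IsDistinguishedWith.ncard_iff (h : IsDistinguishedWith γ β) (hn : ∀ w, ¬ IsNil β w) :
    {w | IsIdem β w}.ncard = 7 ↔ ∀ w, IsIdem β w → mult β w = 1 := by
  classical
  have hset : {w | IsIdem β w} = ((Finset.univ.image (seven γ (seventh γ)) :
      Finset (Fin 3 → ℂ)) : Set (Fin 3 → ℂ)) := by
    ext w
    simp [h.isIdem_iff hn]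
  have hinj : {w | IsIdem β w}.ncard = 7 ↔ Function.Injective (seven γ (seventh γ)) := by
    rw [hset, Set.ncard_coe_finset]
    constructor
    · intro h7
      have := Finset.card_image_iff.mp
        (h7.trans (by simp : 7 = (Finset.univ : Finset (Fin 7)).card))
      simpa [Set.injOn_univ] using this
    · intro hi
      rw [Finset.card_image_of_injective _ hi]
      simp
  rw [hinj]
  constructor
  · intro hi w hw
    obtain ⟨i, rfl⟩ := (h.isIdem_iff hn w).mp hw
    rw [h.mult_eq_card hn hw, Nat.card_eq_one_iff_unique]
    exact ⟨⟨fun a b => Subtype.ext (hi (a.2.trans b.2.symm))⟩, ⟨⟨i, rfl⟩⟩⟩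
  · intro hm i j hij
    have hw := (h.isIdem_iff hn _).mpr ⟨j, rfl⟩
    have h1 := hm _ hw
    rw [h.mult_eq_card hn hw, Nat.card_eq_one_iff_unique] at h1
    have := h1.1.elim ⟨i, hij⟩ ⟨j, rfl⟩
    exact congrArg Subtype.val this

theorem IsDistinguishedWith.ncard_eq_seven (h : IsDistinguishedWith γ β)
    (hn : ∀ w, ¬ IsNil β w) (hJ : ∀ i, jacNum γ i ≠ 0) : {w | IsIdem β w}.ncard = 7 := by
  rw [h.ncard_iff hn]
  intro w hw
  have hinj := points_injective h.det_ne_zero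
  rw [h.mult_eq_card hn hw, Nat.card_eq_one_iff_unique]
  obtain ⟨i, rfl⟩ := (h.isIdem_iff hn w).mp hw
  refine ⟨⟨fun a b => Subtype.ext ?_⟩, ⟨⟨i, rfl⟩⟩⟩
  have hs : ∀ i, seventh γ ≠ points γ i := by
    obtain ⟨-, ⟨hs, -⟩ | ⟨i, -, hi⟩⟩ := h.seventh_cases hn
    exacts [hs, absurd hi (hJ i)]
  obtain ⟨a, ha⟩ := a
  obtain ⟨b, hb⟩ := b
  have hab := ha.trans hb.symm
  change a = b
  rw [seven_eq, seven_eq] at hab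
  split_ifs at hab with h1 h2 h2
  · rw [h1, h2]
  · exact absurd hab (hs _)
  · exact absurd hab.symm (hs _)
  · exact hinj hab

end NoNilpotent

end QuadField

/-! ### Generic parameters exclude nilpotents -/

namespace QuadField

open MvPolynomial

/-- The coefficients of six relations between the monomials of degree two in `w_m w_{m+1}` that
hold for every nilpotent `w` of `d x_k² + ∑ c_{km} x_m x_{m+1}`. -/
def nilMat {R : Type*} [CommRing R] (d : R) (c : Fin 3 → Fin 3 → R) :
    Matrix (Fin 3 ⊕ Fin 3) (Fin 3 ⊕ Fin 3) R :=
  Matrix.fromBlocks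
    (Matrix.of fun m n => (if m = n then d ^ 2 else 0) - c m n * c (m + 1) n)
    (Matrix.of fun m n => -(c m n * c (m + 1) (n + 1) + c m (n + 1) * c (m + 1) n))
    (Matrix.of fun m n => if n = m + 2 then c (m + 1) (m + 2) else 0)
    (Matrix.of fun m n => (if m = n then d else 0) + (if n = m + 2 then c (m + 1) m else 0) +
      if n = m + 1 then c (m + 1) (m + 1) else 0)

/-- A polynomial in the parameters whose nonvanishing excludes nilpotents. -/
def nilNum {R : Type*} [CommRing R] (γ : Fin 3 × Fin 3 → R) : R :=
  (nilMat (crossMat γ).det (crossNum γ)).det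

theorem eval_nilNum (γ : Fin 3 × Fin 3 → ℂ) :
    eval γ (nilNum (X : Fin 3 × Fin 3 → MvPolynomial (Fin 3 × Fin 3) ℂ)) = nilNum γ := by
  rw [nilNum, RingHom.map_det, nilNum]
  congr 1
  ext i j
  rcases i with i | i <;> rcases j with j | j <;>
    simp [nilMat, eval_crossNum, eval_det_crossMat, apply_ite (eval γ)]

theorem nilNum_baseParam : nilNum (baseParam : Fin 3 × Fin 3 → ℂ) = 1 := by
  have : nilMat (1 : ℂ) 0 = 1 := by
    ext i j
    rcases i with i | i <;> rcases j with j | j <;> simp [nilMat, Matrix.one_apply]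
  rw [nilNum, crossMat_baseParam, crossNum_baseParam, Matrix.det_one, this, Matrix.det_one]

/-- With `u_n = w_n w_{n+1}`, the upper rows come from multiplying the equations for `w_m²` and
`w_{m+1}²`, the lower rows from multiplying the equation for `w_{m+1}²` by `w_m w_{m+2}`. The
unknowns are the `u_n²` and `u_n u_{n+1}`. -/
theorem nilMat_mulVec {d : ℂ} {c : Fin 3 → Fin 3 → ℂ} {w : Fin 3 → ℂ}
    (h : ∀ k, d * w k ^ 2 + ∑ m, c k m * (w m * w (m + 1)) = 0) :
    (nilMat d c).mulVec (Sum.elim (fun n => (w n * w (n + 1)) ^ 2)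
      fun n => (w n * w (n + 1)) * (w (n + 1) * w (n + 1 + 1))) = 0 := by
  have h0 := h 0
  have h1 := h 1
  have h2 := h 2
  simp only [Fin.sum_univ_three] at h0 h1 h2
  funext i
  rcases i with i | i <;> fin_cases i <;>
    simp [nilMat, Matrix.mulVec, dotProduct, Fin.sum_univ_three] at h0 h1 h2 ⊢
  · linear_combination d * w 1 ^ 2 * h0 -
      (c 0 0 * (w 0 * w 1) + c 0 1 * (w 1 * w 2) + c 0 2 * (w 2 * w 0)) * h1
  · linear_combination d * w 2 ^ 2 * h1 -
      (c 1 0 * (w 0 * w 1) + c 1 1 * (w 1 * w 2) + c 1 2 * (w 2 * w 0)) * h2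
  · linear_combination d * w 0 ^ 2 * h2 -
      (c 2 0 * (w 0 * w 1) + c 2 1 * (w 1 * w 2) + c 2 2 * (w 2 * w 0)) * h0
  · linear_combination w 0 * w 2 * h1
  · linear_combination w 1 * w 0 * h2
  · linear_combination w 2 * w 1 * h0

theorem IsDistinguishedWith.not_isNil {γ : Fin 3 × Fin 3 → ℂ} {β : Coeff}
    (h : IsDistinguishedWith γ β) (hR : nilNum γ ≠ 0) (w : Fin 3 → ℂ) : ¬ IsNil β w := by
  rintro ⟨hw0, hw⟩
  rw [h.hasCross.field_eq] at hw
  have hA := h.det_ne_zero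
  have h1 : ∀ k, (crossMat γ).det * w k ^ 2 + ∑ m, crossNum γ k m * (w m * w (m + 1)) = 0 := by
    intro k
    have := congrFun hw k
    simp only [quadMap, Pi.zero_apply] at this
    rw [← mul_zero (crossMat γ).det, ← this, mul_add, Finset.mul_sum]
    congr 1
    exact Finset.sum_congr rfl fun m _ => by rw [crossNum_eq h.quadMap_vec, mul_assoc]
  have h2 := Matrix.eq_zero_of_mulVec_eq_zero hR (nilMat_mulVec h1)
  have h3 : ∀ m, w m * w (m + 1) = 0 := fun m => by
    have := congrFun h2 (Sum.inl m)
    simpa using this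
  refine hw0 (funext fun k => ?_)
  have := congrFun hw k
  simpa [quadMap, h3] using this

/-- The polynomial in the parameters that defines the generic open set. -/
noncomputable def genericPoly : MvPolynomial (Fin 3 × Fin 3) ℂ :=
  (crossMat X).det * nilNum X * ∏ i, jacNum X i

theorem eval_genericPoly (γ : Fin 3 × Fin 3 → ℂ) :
    eval γ genericPoly = (crossMat γ).det * nilNum γ * ∏ i, jacNum γ i := by
  simp only [genericPoly, map_mul, map_prod, eval_det_crossMat, eval_nilNum, eval_jacNum]

theorem exists_generic_parameters :
    ∃ U : Set (Fin 3 × Fin 3 → ℂ), IsZariskiOpen U ∧ U.Nonempty ∧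
      ∀ γ ∈ U, (∃ β, IsDistinguishedWith γ β) ∧
        ∀ β, IsDistinguishedWith γ β → (∀ w, ¬ IsNil β w) ∧ {w | IsIdem β w}.ncard = 7 := by
  refine ⟨_, isZariskiOpen_eval_ne_zero genericPoly, ⟨baseParam, ?_⟩, fun γ hγ => ?_⟩
  · simp only [Set.mem_ofPred_eq, eval_genericPoly, crossMat_baseParam, nilNum_baseParam,
      Matrix.det_one, one_mul]
    exact Finset.prod_ne_zero_iff.mpr fun i _ => jacNum_baseParam_ne_zero i
  · simp only [Set.mem_ofPred_eq, eval_genericPoly, mul_ne_zero_iff] at hγ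
    obtain ⟨⟨hA, hR⟩, hJ⟩ := hγ
    refine ⟨⟨_, (hasCross_fieldOf _).isDistinguishedWith hA (quadMap_crossNum_div hA)⟩,
      fun β h => ?_⟩
    exact ⟨h.not_isNil hR, h.ncard_eq_seven (h.not_isNil hR) fun i =>
      Finset.prod_ne_zero_iff.mp hJ i (Finset.mem_univ i)⟩

end QuadField

/-! ### Transforms of distinguished fields are generic -/

namespace QuadField

open MvPolynomial Filter Topology

section Generic

variable {R S : Type*} [CommRing R] [CommRing S]

/-- The coefficients of `A ∘ p ∘ T`, where `p` has the coefficients `b`. -/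
def substCoeff (A T : Matrix (Fin 3) (Fin 3) R) (b : CoeffIndex → R) (p : CoeffIndex) : R :=
  ∑ m, A p.2 m * ∑ ab : {ij : Fin 3 × Fin 3 // ij.1 ≤ ij.2}, b (ab, m) *
    (if p.1.1.1 = p.1.1.2 then T ab.1.1 p.1.1.1 * T ab.1.2 p.1.1.1
      else T ab.1.1 p.1.1.1 * T ab.1.2 p.1.1.2 + T ab.1.1 p.1.1.2 * T ab.1.2 p.1.1.1)

/-- The parameters of a transformed distinguished field: a matrix, and the parameters `γ`. -/
abbrev ParamIndex : Type := (Fin 3 × Fin 3) ⊕ (Fin 3 × Fin 3)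

/-- The matrix among the parameters. -/
def transMat (y : ParamIndex → R) : Matrix (Fin 3) (Fin 3) R := Matrix.of fun i j => y (.inl (i, j))

/-- The coefficients of `T⁻¹ ∘ p ∘ T` for the distinguished field `p` with parameters `γ`,
multiplied by the determinants of `T` and of `crossMat γ`. -/
def transCoeff (y : ParamIndex → R) : CoeffIndex → R :=
  substCoeff (transMat y).adjugate (transMat y)
    (fieldOf (crossMat (y ∘ Sum.inr)).det (crossNum (y ∘ Sum.inr)))

theorem map_transMat (f : R →+* S) (y : ParamIndex → R) :
    (transMat y).map f = transMat (f ∘ y) := rfl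

theorem map_det_transMat (f : R →+* S) (y : ParamIndex → R) :
    f (transMat y).det = (transMat (f ∘ y)).det := by
  rw [← map_transMat, RingHom.map_det]
  rfl

theorem map_fieldOf (f : R →+* S) (d : R) (c : Fin 3 → Fin 3 → R) (p : CoeffIndex) :
    f (fieldOf d c p) = fieldOf (f d) (fun k m => f (c k m)) p := by
  simp [fieldOf, apply_ite f]

theorem map_transCoeff (f : R →+* S) (y : ParamIndex → R) (p : CoeffIndex) :
    f (transCoeff y p) = transCoeff (f ∘ y) p := by
  have h1 : ∀ i j, f ((transMat y).adjugate i j) = (transMat (f ∘ y)).adjugate i j := fun i j => by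
    rw [← map_transMat]
    exact congrFun (congrFun (RingHom.map_adjugate f (transMat y)) i) j
  have h2 : ∀ i j, f (transMat y i j) = transMat (f ∘ y) i j := fun _ _ => rfl
  simp only [transCoeff, substCoeff, map_sum, map_mul, h1, apply_ite f, map_add, h2, map_fieldOf,
    map_det_crossMat, map_crossNum]
  rfl

end Generic

theorem field_substCoeff (A T : Matrix (Fin 3) (Fin 3) ℂ) (β : Coeff) (x : Fin 3 → ℂ) :
    field (substCoeff A T β) x = A.mulVec (field β (T.mulVec x)) := by
  have h : ∀ ab : {ij : Fin 3 × Fin 3 // ij.1 ≤ ij.2},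
      ∑ ij : {ij : Fin 3 × Fin 3 // ij.1 ≤ ij.2},
        (if ij.1.1 = ij.1.2 then T ab.1.1 ij.1.1 * T ab.1.2 ij.1.1
          else T ab.1.1 ij.1.1 * T ab.1.2 ij.1.2 + T ab.1.1 ij.1.2 * T ab.1.2 ij.1.1) *
          (x ij.1.1 * x ij.1.2) = T.mulVec x ab.1.1 * T.mulVec x ab.1.2 := by
    intro ab
    rw [sum_pairs]
    simp [Matrix.mulVec, dotProduct, Fin.sum_univ_three]
    ring
  funext k
  change _ = ∑ m, A k m * field β (T.mulVec x) m
  simp only [field_apply, substCoeff, Finset.sum_mul]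
  rw [Finset.sum_comm]
  refine Finset.sum_congr rfl fun m _ => ?_
  simp only [mul_assoc, ← Finset.mul_sum, Finset.sum_mul]
  rw [Finset.sum_comm]
  congr 1
  refine Finset.sum_congr rfl fun ab _ => ?_
  rw [← Finset.mul_sum, h]

theorem field_injective : Function.Injective field := by
  intro β β' h
  have h1 : ∀ x k, field β x k = field β' x k := fun x k => by rw [h]
  simp only [field_apply, sum_pairs] at h1
  have d0 := h1 ![1, 0, 0]
  have d1 := h1 ![0, 1, 0]
  have d2 := h1 ![0, 0, 1]
  have d01 := h1 ![1, 1, 0]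
  have d02 := h1 ![1, 0, 1]
  have d12 := h1 ![0, 1, 1]
  simp at d0 d1 d2 d01 d02 d12
  simp only [d0, d1, d2, add_left_inj, add_right_inj] at d01 d02 d12
  funext ⟨⟨⟨i, j⟩, hij⟩, k⟩
  fin_cases i <;> fin_cases j <;>
    first
    | exact absurd hij (by decide)
    | apply d0
    | apply d1
    | apply d2
    | apply d01
    | apply d02
    | apply d12

theorem field_smul (β : Coeff) (a : ℂ) (x : Fin 3 → ℂ) : field β (a • x) = a ^ 2 • field β x := by
  funext k
  simp only [field_apply, Pi.smul_apply, smul_eq_mul, Finset.mul_sum]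
  exact Finset.sum_congr rfl fun _ _ => by ring

theorem field_fieldOf (d : ℂ) (c : Fin 3 → Fin 3 → ℂ) (hd : d ≠ 0) (x : Fin 3 → ℂ) :
    field (fieldOf d c) x = d • field (fieldOf 1 fun k m => c k m / d) x := by
  funext k
  simp only [field_apply, Pi.smul_apply, smul_eq_mul, Finset.mul_sum]
  refine Finset.sum_congr rfl fun p _ => ?_
  simp only [fieldOf]
  split_ifs <;> field_simp
  ring

theorem field_transCoeff {y : ParamIndex → ℂ} (hA : (crossMat (y ∘ Sum.inr)).det ≠ 0)
    (x : Fin 3 → ℂ) :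
    field (transCoeff y) x = (crossMat (y ∘ Sum.inr)).det • (transMat y).adjugate.mulVec
      (field (fieldOf 1 fun k m => crossNum (y ∘ Sum.inr) k m / (crossMat (y ∘ Sum.inr)).det)
        ((transMat y).mulVec x)) := by
  rw [transCoeff, field_substCoeff, field_fieldOf _ _ hA, Matrix.mulVec_smul]

theorem transCoeff_isTransformOf {y : ParamIndex → ℂ} (hT : (transMat y).det ≠ 0)
    (hA : (crossMat (y ∘ Sum.inr)).det ≠ 0) :
    ∃ β', IsDistinguished β' ∧ IsTransformOf (transCoeff y) β' := by
  refine ⟨_, ⟨_, (hasCross_fieldOf _).isDistinguishedWith hA (quadMap_crossNum_div hA)⟩, ?_⟩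
  set d := (crossMat (y ∘ Sum.inr)).det
  -- Replacing `T` by `λ T` multiplies `T⁻¹ ∘ p ∘ T` by `λ`. The choice `λ = d * det T` turns the
  -- inverse into `d` times the adjugate.
  have hU : IsUnit ((d * (transMat y).det) • transMat y) := by
    rw [Matrix.isUnit_iff_isUnit_det, Matrix.det_smul]
    exact (mul_ne_zero (pow_ne_zero _ (mul_ne_zero hA hT)) hT).isUnit
  refine ⟨hU.unit, fun x => ?_⟩
  rw [Matrix.coe_units_inv, IsUnit.unit_spec, field_transCoeff hA, Matrix.smul_mulVec,
    field_smul, Matrix.inv_def, Matrix.adjugate_smul, Matrix.det_smul, Matrix.smul_mulVec,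
    Matrix.smul_mulVec, Matrix.mulVec_smul, smul_smul, smul_smul]
  congr 1
  simp only [Fintype.card_fin, Ring.inverse_eq_inv']
  field_simp
  change d * d * _ = _
  ring

theorem exists_field_transCoeff_eq {T M : Matrix (Fin 3) (Fin 3) ℂ} (hMT : M * T = 1)
    {γ : Fin 3 × Fin 3 → ℂ} (hA : (crossMat γ).det ≠ 0) :
    ∃ y, ∀ x, field (transCoeff y) x = M.mulVec
      (field (fieldOf 1 fun k m => crossNum γ k m / (crossMat γ).det) (T.mulVec x)) := by
  have hdet : T.det ≠ 0 := by
    have := congrArg Matrix.det hMT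
    rw [Matrix.det_mul, Matrix.det_one] at this
    exact right_ne_zero_of_mul (this ▸ one_ne_zero)
  have hadj : T.adjugate = T.det • M := by
    have h1 : M * T * T.adjugate = T.det • M := by
      rw [Matrix.mul_assoc, Matrix.mul_adjugate, Matrix.mul_smul, Matrix.mul_one]
    rwa [hMT, Matrix.one_mul] at h1
  -- Scaling `T` by `a` multiplies the adjugate by `a ^ 2` and the quadratic field by `a ^ 2`, hence
  -- the fourth root.
  obtain ⟨a, ha⟩ := IsAlgClosed.exists_pow_nat_eq
    (((crossMat γ).det * T.det)⁻¹) (n := 4) (by norm_num)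
  have h4 : a ^ 4 * ((crossMat γ).det * T.det) = 1 := by
    rw [ha]
    exact inv_mul_cancel₀ (mul_ne_zero hA hdet)
  refine ⟨Sum.elim (fun p => (a • T) p.1 p.2) γ, fun x => ?_⟩
  have hT : transMat (Sum.elim (fun p => (a • T) p.1 p.2) γ) = a • T := rfl
  rw [field_transCoeff (by rwa [Sum.elim_comp_inr]), Sum.elim_comp_inr, hT, Matrix.adjugate_smul,
    hadj, Matrix.smul_mulVec, Matrix.smul_mulVec, Matrix.smul_mulVec, field_smul,
    Matrix.mulVec_smul, smul_smul, smul_smul, smul_smul, Fintype.card_fin]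
  convert one_smul ℂ _
  linear_combination h4

theorem crossMat_smul (a : ℂ) (γ : Fin 3 × Fin 3 → ℂ) :
    crossMat (a • γ) = a ^ 2 • crossMat γ := by
  ext i m
  simp only [crossMat, Matrix.of_apply, Matrix.smul_apply, Pi.smul_apply, smul_eq_mul]
  ring

/-- The columns of `M` are three independent fixed points. Using them as a basis makes the field
distinguished, with the coordinates of the `w i` as parameters. The adjugate in `hA` differs from
the inverse only by a scalar. -/
theorem exists_transCoeff_eq {β : Coeff} {M : Matrix (Fin 3) (Fin 3) ℂ} {w : Fin 3 → Fin 3 → ℂ}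
    (hs : ∀ i, field β (M.mulVec (Pi.single i 1)) = M.mulVec (Pi.single i 1))
    (hw : ∀ i, field β (w i) = w i) (hdet : M.det ≠ 0)
    (hA : (crossMat fun p => M.adjugate.mulVec (w p.1) p.2).det ≠ 0) :
    ∃ y, transCoeff y = β := by
  obtain ⟨T, hT⟩ : ∃ T, T = M.det⁻¹ • M.adjugate := ⟨_, rfl⟩
  have hMT : M * T = 1 := by
    rw [hT, Matrix.mul_smul, Matrix.mul_adjugate, smul_smul, inv_mul_cancel₀ hdet, one_smul]
  have hTM : T * M = 1 := mul_eq_one_comm.mp hMT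
  obtain ⟨γ, hγ⟩ : ∃ γ : Fin 3 × Fin 3 → ℂ, ∀ i, (fun j => γ (i, j)) = T.mulVec (w i) :=
    ⟨fun p => T.mulVec (w p.1) p.2, fun _ => rfl⟩
  have hA' : (crossMat γ).det ≠ 0 := by
    have : γ = M.det⁻¹ • fun p => M.adjugate.mulVec (w p.1) p.2 := by
      funext ⟨i, j⟩
      rw [congrFun (hγ i) j, hT, Matrix.smul_mulVec]
      rfl
    rw [this, crossMat_smul, Matrix.det_smul]
    exact mul_ne_zero (pow_ne_zero _ (pow_ne_zero _ (inv_ne_zero hdet))) hA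
  have hc := hasCross_of_field_single (β := substCoeff T M β) fun i => by
    rw [field_substCoeff, hs, Matrix.mulVec_mulVec, hTM, Matrix.one_mulVec]
  have hv : ∀ i, quadMap (crossCoeff (substCoeff T M β)) (fun j => γ (i, j)) =
      fun j => γ (i, j) := fun i => by
    rw [← hc.field_eq, hγ, field_substCoeff, Matrix.mulVec_mulVec, hMT, Matrix.one_mulVec, hw]
  have hfield : ∀ x, field (fieldOf 1 fun k m => crossNum γ k m / (crossMat γ).det) x =
      T.mulVec (field β (M.mulVec x)) := fun x => by
    rw [← field_substCoeff, (hasCross_fieldOf _).field_eq, hc.field_eq]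
    congr 1
    funext k m
    rw [crossNum_eq hv, mul_div_cancel_left₀ _ hA']
  obtain ⟨y, hy⟩ := exists_field_transCoeff_eq hMT hA'
  refine ⟨y, field_injective (funext fun x => ?_)⟩
  rw [hy, hfield, Matrix.mulVec_mulVec, Matrix.mulVec_mulVec, hMT, Matrix.one_mulVec,
    Matrix.one_mulVec]

/-- The fixed points `e_i` and the rows of `baseParam` persist for fields near `x_k²`, and both
determinants stay nonzero. -/
theorem eventually_exists_transCoeff_eq :
    ∀ᶠ β in 𝓝 (fieldOf 1 0 : Coeff), ∃ y, transCoeff y = β := by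
  let Z := Fin 3 ⊕ Fin 3 → Fin 3 → ℂ
  let M : Z → Matrix (Fin 3) (Fin 3) ℂ := fun z => (Matrix.of fun i => z (.inl i)).transpose
  let N : Z → Matrix (Fin 3) (Fin 3) ℂ := fun z =>
    crossMat fun p => (M z).adjugate.mulVec (z (.inr p.1)) p.2
  let z₀ : Z := Sum.elim (fun i => Pi.single i 1) fun i j => baseParam (i, j)
  have hM : Continuous M := by
    refine continuous_matrix fun i j => ?_
    simp only [M, Matrix.transpose_apply, Matrix.of_apply]
    fun_prop
  have hN : Continuous N := by
    refine continuous_matrix fun i j => ?_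
    have hv : ∀ i j, Continuous fun z : Z => (M z).adjugate.mulVec (z (.inr i)) j := fun i j =>
      (continuous_apply j).comp (hM.matrix_adjugate.matrix_mulVec (continuous_apply _))
    exact (hv i j).mul (hv i (j + 1))
  have hM0 : M z₀ = 1 := by
    ext i j
    simp [M, z₀, Matrix.one_apply, Pi.single_apply]
  have hN0 : N z₀ = 1 := by
    simp only [N, hM0, Matrix.adjugate_one, Matrix.one_mulVec]
    exact crossMat_baseParam
  have hO : ∀ᶠ z in 𝓝 z₀, (M z).det ≠ 0 ∧ (N z).det ≠ 0 := by
    refine (hM.matrix_det.continuousAt.eventually_ne ?_).and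
      (hN.matrix_det.continuousAt.eventually_ne ?_)
    · rw [hM0, Matrix.det_one]
      exact one_ne_zero
    · rw [hN0, Matrix.det_one]
      exact one_ne_zero
  obtain ⟨ε, hε, hball⟩ := Metric.eventually_nhds_iff_ball.mp hO
  have hsq : ∀ i k, z₀ i k ^ 2 = z₀ i k := by
    rintro (i | i) k
    · simp only [z₀, Sum.elim_inl, Pi.single_apply]
      split_ifs <;> simp
    · simp only [z₀, Sum.elim_inr, baseParam]
      split_ifs <;> simp
  have hroots := eventually_all.mpr fun i =>
    eventually_exists_field_eq (hsq i) (Metric.ball_mem_nhds (z₀ i) hε)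
  filter_upwards [hroots] with β hβ
  choose z hz hfix using hβ
  obtain ⟨h1, h2⟩ := hball z (Metric.mem_ball.mpr ((dist_pi_lt_iff hε).mpr hz))
  refine exists_transCoeff_eq (M := M z) (fun i => ?_) (fun i => hfix (.inr i)) h1 h2
  have hcol : (M z).mulVec (Pi.single i 1) = z (.inl i) := by
    funext k
    simp [M]
  rw [hcol, hfix]

theorem exists_generic_transforms : ∃ U : Set Coeff, IsZariskiOpen U ∧ U.Nonempty ∧
    U ⊆ {β | ∃ β', IsDistinguished β' ∧ IsTransformOf β β'} := by
  let g : MvPolynomial ParamIndex ℂ := (transMat X).det * (crossMat (X ∘ Sum.inr)).det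
  have hX : ∀ y : ParamIndex → ℂ, eval y ∘ X = y := fun y => funext fun i => eval_X i
  have hg : ∀ y, eval y g = (transMat y).det * (crossMat (y ∘ Sum.inr)).det := fun y => by
    rw [map_mul, map_det_transMat, map_det_crossMat, ← Function.comp_assoc, hX]
  have hg0 : g ≠ 0 := fun h => by
    have h1 := hg (Sum.elim (fun p => if p.1 = p.2 then 1 else 0) baseParam)
    have h2 : transMat (Sum.elim (fun p => if p.1 = p.2 then 1 else 0) baseParam :
        ParamIndex → ℂ) = 1 := rfl
    rw [h, h2, Sum.elim_comp_inr, crossMat_baseParam] at h1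
    simp at h1
  -- A polynomial in the kernel vanishes on the image, which contains an open set in the Euclidean
  -- topology.
  have hinj : Function.Injective
      (aeval (R := ℂ) (transCoeff X : CoeffIndex → MvPolynomial ParamIndex ℂ)) := by
    rw [injective_iff_map_eq_zero]
    intro F hF
    refine eq_zero_of_eventually_eval_eq_zero F (fieldOf 1 0) ?_
    filter_upwards [eventually_exists_transCoeff_eq] with β ⟨y, hy⟩
    have h1 := congrArg (eval y) hF
    rw [map_zero, ← coe_aeval_eq_eval, RingHom.coe_coe, ← AlgHom.comp_apply, comp_aeval] at h1
    have h2 : (fun p => aeval y (transCoeff X p : MvPolynomial ParamIndex ℂ)) = β := by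
      rw [← hy]
      funext p
      rw [aeval_eq_eval, map_transCoeff, hX]
    rw [h2] at h1
    exact h1
  obtain ⟨a, ha, hU⟩ := exists_forall_exists_eval_eq _ g hg0 hinj
  refine ⟨_, isZariskiOpen_eval_ne_zero a, ?_, fun β hβ => ?_⟩
  · by_contra hne
    refine ha (funext fun x => ?_)
    by_contra hx
    exact hne ⟨x, by simpa using hx⟩
  · obtain ⟨y, hy, hyβ⟩ := hU β hβ
    rw [hg] at hy
    have : transCoeff y = β := funext fun p => by
      rw [← hyβ, map_transCoeff, hX]
    exact this ▸ transCoeff_isTransformOf (left_ne_zero_of_mul hy) (right_ne_zero_of_mul hy)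

end QuadField

/-! ### The main theorem -/

theorem mainTheorem9 :
    -- (a)
    (∃ U : Set QuadField.Coeff, QuadField.IsZariskiOpen U ∧ U.Nonempty ∧
      U ⊆ {β | ∃ β', QuadField.IsDistinguished β' ∧ QuadField.IsTransformOf β β'}) ∧
    -- (b) the fractions `N k / D k` are the coordinates of the seventh idempotent
    (∃ N D : Fin 3 → MvPolynomial (Fin 3 × Fin 3) ℂ,
      -- all distinguished fields without nilpotents
      (∀ (γ : Fin 3 × Fin 3 → ℂ) (β : QuadField.Coeff),
        QuadField.IsDistinguishedWith γ β → (∀ w, ¬ QuadField.IsNil β w) →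
        (∀ k, MvPolynomial.eval γ (D k) ≠ 0) ∧
        (∀ w, QuadField.IsIdem β w ↔
          ∃ i, QuadField.seven γ (QuadField.ratPoint N D γ) i = w) ∧
        (∀ w, QuadField.IsIdem β w → QuadField.mult β w =
          Nat.card {i : Fin 7 // QuadField.seven γ (QuadField.ratPoint N D γ) i = w}) ∧
        ({w | QuadField.IsIdem β w}.ncard = 7 ↔
          ∀ w, QuadField.IsIdem β w → QuadField.mult β w = 1)) ∧
      -- generic parameters
      (∃ U : Set (Fin 3 × Fin 3 → ℂ), QuadField.IsZariskiOpen U ∧ U.Nonempty ∧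
        ∀ γ ∈ U, (∃ β, QuadField.IsDistinguishedWith γ β) ∧
          ∀ β, QuadField.IsDistinguishedWith γ β →
            (∀ w, ¬ QuadField.IsNil β w) ∧ {w | QuadField.IsIdem β w}.ncard = 7)) := by
  refine ⟨QuadField.exists_generic_transforms, QuadField.seventhNum, QuadField.seventhDen,
    fun γ β h hn => ?_, QuadField.exists_generic_parameters⟩
  rw [QuadField.ratPoint_seventh]
  refine ⟨fun k => ?_, h.isIdem_iff hn, fun w hw => h.mult_eq_card hn hw, h.ncard_iff hn⟩
  rw [QuadField.seventhDen, QuadField.eval_moment]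
  exact (h.seventh_cases hn).1
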